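/- Let $\mu\in(0,1)$ and $-\infty<p_1<p_2<+\infty$. Let $u_0$ be a tempered distribution on $\mathbb R$ satisfying Condition $(C_{p_1,p_2,\mu})$: its Fourier transform (normalised as $\mathcal F u_0(p)=\int_{\mathbb R}u_0(x)e^{-ixp}\,dx$ and taken in the sense of tempered distributions) is a function which vanishes outside $[p_1,p_2]$ and satisfies $$\mathcal F u_0(p)=(p-p_1)^{\mu-1}\,\tilde u(p)\qquad\text{for } p\in(p_1,p_2),$$ where $\tilde u\in\mathcal C^1([p_1,p_2],\mathbb C)$ and $\tilde u(p_1)\neq0$; moreover $\mathcal F u_0$ is continuous from the left at $p_2$ and $\mathcal F u_0(p_2)=0$. Let $u$ be the solution of the free Schrödinger equation $$\big[i\partial_t+\partial_x^2\big]u(t,x)=0\quad(t>0,\ x\in\mathbb R),\qquad u(0,\cdot)=u_0,$$ in the sense of tempered distributions, where the pairing $(t,\varphi)\mapsto\langle u(t,\cdot),\varphi\rangle$ is continuous on $[0,\infty)\times\mathcal S(\mathbb R)$ and, for each $t>0$, $u(t,\cdot)$ denotes the continuous function representing the solution at time $t$. Fix $\delta\in\big(\max\{\mu,\tfrac12\},1\big)$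 and $\varepsilon_1,\varepsilon_2>0$ with $p_1+\varepsilon_1<p_2-\varepsilon_2$. Then there is a constant $c\ge0$, independent of $t$ and $x$, such that for all $t>0$ and $x\in\mathbb R$ with $$p_1+\varepsilon_1\le\frac{x}{2t}\le p_2-\varepsilon_2$$ we have $$\Big|u(t,x)-H(t,x,u_0)\,t^{-\frac12}-K_\mu(t,x,u_0)\,t^{-\mu}\Big|\le c\,\big(t^{-1}+t^{-\delta}\big),$$ where $$H(t,x,u_0)=\frac{1}{2\sqrt\pi}\,e^{-i\frac{\pi}{4}}\,e^{i\frac{x^2}{4t}}\,\tilde u\Big(\frac{x}{2t}\Big)\Big(\frac{x}{2t}-p_1\Big)^{\mu-1},$$ $$K_\mu(t,x,u_0)=\frac{\Gamma(\mu)}{2^{\mu+1}\pi}\,e^{i\frac{\pi\mu}{2}}\,e^{i(-tp_1^2+xp_1)}\,\tilde u(p_1)\Big(\frac{x}{2t}-p_1\Big)^{-\mu}.$$ -/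

import Mathlib

open Set MeasureTheory
open scoped SchwartzMap FourierTransform

noncomputable section

namespace FreeSchrodinger

/-- The Fourier transform `(F φ)(p) = ∫ φ(x) e^{-ixp} dx` (angular frequency, no normalising factor)
on the Schwartz space: Mathlib's transform evaluated at `p / (2π)`. -/
def schwartzFourier : 𝓢(ℝ, ℂ) →L[ℂ] 𝓢(ℝ, ℂ) :=
  (SchwartzMap.compCLMOfContinuousLinearEquiv ℂ
    (ContinuousLinearEquiv.unitsEquivAut ℝ
      (Units.mk0 ((2 * Real.pi)⁻¹) (inv_ne_zero Real.two_pi_pos.ne')))).comp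
    (FourierTransform.fourierCLM ℂ 𝓢(ℝ, ℂ))

theorem schwartzFourier_apply (φ : 𝓢(ℝ, ℂ)) (p : ℝ) :
    schwartzFourier φ p = ∫ x : ℝ, φ x * Complex.exp (-Complex.I * x * p) := by
  have h : schwartzFourier φ p = 𝓕 (φ : ℝ → ℂ) (p * (2 * Real.pi)⁻¹) := rfl
  rw [h, Real.fourier_real_eq_integral_exp_smul]
  refine integral_congr_ae (Filter.Eventually.of_forall fun x => ?_)
  have hpi : (Real.pi : ℂ) ≠ 0 := by exact_mod_cast Real.pi_ne_zero
  simp only [smul_eq_mul]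
  rw [mul_comm]
  congr 2
  push_cast
  field_simp

/-- The Fourier transform on tempered distributions, by duality. -/
def fourier (T : 𝓢'(ℝ, ℂ)) : 𝓢'(ℝ, ℂ) :=
  PointwiseConvergenceCLM.precomp ℂ schwartzFourier T

theorem fourier_apply (T : 𝓢'(ℝ, ℂ)) (φ : 𝓢(ℝ, ℂ)) :
    fourier T φ = T (schwartzFourier φ) := rfl

/-- The tempered distribution `T` is given by integration against the function `f`. -/
def IsGivenBy (T : 𝓢'(ℝ, ℂ)) (f : ℝ → ℂ) : Prop :=
  ∀ φ : 𝓢(ℝ, ℂ), Integrable (fun x : ℝ => f x * φ x) ∧ T φ = ∫ x : ℝ, f x * φ x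

/-- The singular amplitude assumption:
`U(p) = (p - p₁)^(μ₁ - 1) (p₂ - p)^(μ₂ - 1) w(p)` on `(p₁, p₂)`, where `w` is of class `C^N` on the
closed interval `[p₁, p₂]` and does not vanish at a genuinely singular endpoint. -/
structure SingularAmplitude (p₁ p₂ μ₁ μ₂ : ℝ) (N : ℕ) (U w : ℝ → ℂ) : Prop where
  formula : ∀ p ∈ Ioo p₁ p₂,
    U p = (((p - p₁) ^ (μ₁ - 1) : ℝ) : ℂ) * (((p₂ - p) ^ (μ₂ - 1) : ℝ) : ℂ) * w p
  contDiffOn : ContDiffOn ℝ N w (Icc p₁ p₂)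
  left_ne_zero : μ₁ ≠ 1 → w p₁ ≠ 0
  right_ne_zero : μ₂ ≠ 1 → w p₂ ≠ 0

/-- The condition on the initial datum `u₀`: its Fourier transform is the function `U`, which vanishes
outside `[p₁, p₂]`, has a singularity of order `μ - 1` at `p₁` with regular factor `w` (of class `C¹`
on `[p₁, p₂]`), and vanishes at the regular endpoint `p₂` (where it is continuous from the left). -/
structure InitialCondition (p₁ p₂ μ : ℝ) (u₀ : 𝓢'(ℝ, ℂ)) (U w : ℝ → ℂ) : Prop where
  fourier_eq : IsGivenBy (fourier u₀) U
  eq_zero_outside : ∀ p, p ∉ Icc p₁ p₂ → U p = 0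
  amplitude : SingularAmplitude p₁ p₂ μ 1 1 U w
  continuous_right : ContinuousWithinAt U (Iic p₂) p₂
  right_eq_zero : U p₂ = 0

/-- `u` is a solution of the Cauchy problem `i ∂ₜu + ∂ₓ²u = 0` for `t > 0`, `u(0, ·) = u₀`, in the sense
of tempered distributions: there is a family `v t`, `t ≥ 0`, of tempered distributions with `v 0 = u₀`,
continuous on `[0, ∞)` in the sense that the pairing `(t, φ) ↦ ⟨v t, φ⟩` is continuous, which satisfies
`∂ₜ v = i ∂ₓ² v` for `t > 0`, and for each `t > 0` the distribution `v t` is the continuous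
function `u t`. -/
def IsSolution (u₀ : 𝓢'(ℝ, ℂ)) (u : ℝ → ℝ → ℂ) : Prop :=
  ∃ v : ℝ → 𝓢'(ℝ, ℂ),
    v 0 = u₀ ∧
    ContinuousOn (fun q : ℝ × 𝓢(ℝ, ℂ) => v q.1 q.2) (Ici 0 ×ˢ univ) ∧
    (∀ t : ℝ, 0 < t → ∀ φ : 𝓢(ℝ, ℂ),
      HasDerivAt (fun s : ℝ => v s φ)
        (Complex.I * TemperedDistribution.derivCLM ℂ (TemperedDistribution.derivCLM ℂ (v t)) φ) t) ∧
    ∀ t : ℝ, 0 < t → Continuous (u t) ∧ IsGivenBy (v t) (u t)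

/-- The coefficient of `t^(-1/2)`:
`H(t,x) = (2√π)⁻¹ e^{-iπ/4} e^{ix²/(4t)} w(x/(2t)) (x/(2t) - p₁)^(μ - 1)`. -/
def coeffH (p₁ μ : ℝ) (w : ℝ → ℂ) (t x : ℝ) : ℂ :=
  1 / (2 * (Real.sqrt Real.pi : ℂ)) * Complex.exp (-Complex.I * (Real.pi / 4)) *
    Complex.exp (Complex.I * (x ^ 2 / (4 * t))) * w (x / (2 * t)) *
    (((x / (2 * t) - p₁) ^ (μ - 1) : ℝ) : ℂ)

/-- The coefficient of `t^(-μ)`: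
`K(t,x) = Γ(μ) (2^(μ+1) π)⁻¹ e^{iπμ/2} e^{i(-t p₁² + x p₁)} w(p₁) (x/(2t) - p₁)^(-μ)`. -/
def coeffK (p₁ μ : ℝ) (w : ℝ → ℂ) (t x : ℝ) : ℂ :=
  ((Real.Gamma μ / ((2 : ℝ) ^ (μ + 1) * Real.pi) : ℝ) : ℂ) *
    Complex.exp (Complex.I * (Real.pi * μ / 2)) *
    Complex.exp (Complex.I * (-t * p₁ ^ 2 + x * p₁)) * w p₁ *
    (((x / (2 * t) - p₁) ^ (-μ) : ℝ) : ℂ)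

end FreeSchrodinger

end

/-!
On the Fourier side the free Schrödinger equation is multiplication by `e^{-itp²}`, so that
`u(t, x) = (2π)⁻¹ ∫ U(p) e^{i(-tp² + xp)} dp`. For an arbitrary solution in the sense of tempered
distributions this is a uniqueness statement. It is proved by duality: the pairing of the solution
with the Fourier transform of `e^{isp²} φ` is constant in `s` (`pairing_schwartzFourier_symbolMul_eq`),
because `s ↦ e^{isp²} φ` is differentiable in Schwartz space (`tendsto_slope_symbolMul_zero`).
Fourier inversion and Fubini then give the formula (`IsSolution.eq_integral`).

With `p₀ = x / (2t)` the phase is `t p₀² - t (p - p₀)²`. The integral over `[p₁, p₂]` has two critical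
points, the singularity `p₁` and the stationary point `p₀`, which stay apart, and the interval is cut
between them.

* Near `p₁`, the substitution `z = s (2a - s)`, `s = p - p₁`, `a = p₀ - p₁`, makes the phase linear and
  produces the Gamma integral `∫ z ^ (μ - 1) e^{itz} dz`, which gives the term in `t ^ (-μ)`; the rest of
  the amplitude vanishes at the endpoint and is `O(t⁻¹)` by parts (`norm_integral_endpoint_sub_le`).
* Near `p₀`, the amplitude is replaced by its value at `p₀`, and the Fresnel integral gives the term
  in `t ^ (-1/2)`. As the amplitude is only `C¹`, the difference quotient at `p₀` is bounded but its
  derivative is only `O(1 / |p - p₀|)`. Cutting at distance `t ^ (-1/2)` and integrating by parts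
  outside gives `O(log t / t)`, and hence `O(t ^ (-δ))` (`norm_integral_mul_cexp_quadratic_le`).

All the errors hold for every `t > 0`, so that small times need no separate treatment.
-/

namespace FreeSchrodinger

open Filter Topology

/-! ### The free evolution on Schwartz space, on the Fourier side -/

theorem hasTemperateGrowth_cexp_I_mul :
    Function.HasTemperateGrowth fun x : ℝ => Complex.exp (Complex.I * x) := by
  have hd : ∀ n : ℕ, iteratedDeriv n (fun x : ℝ => Complex.exp (Complex.I * x)) =
      fun x : ℝ => Complex.I ^ n * Complex.exp (Complex.I * x) := by
    intro n
    induction n with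
    | zero => simp
    | succ n ih =>
      rw [iteratedDeriv_succ, ih]
      funext x
      have h1 : HasDerivAt (fun x : ℝ => Complex.exp (Complex.I * x))
          (Complex.exp (Complex.I * x) * Complex.I) x := by
        simpa using ((Complex.ofRealCLM.hasDerivAt (x := x)).const_mul Complex.I).cexp
      rw [(h1.const_mul _).deriv]
      ring
  refine ⟨Complex.contDiff_exp.comp (contDiff_const.mul Complex.ofRealCLM.contDiff),
    fun n => ⟨0, 1, fun x => ?_⟩⟩
  rw [norm_iteratedFDeriv_eq_norm_iteratedDeriv, hd]
  simp [Complex.norm_exp]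

/-- The multiplier `p ↦ e^{isp²}` of the free Schrödinger evolution. -/
noncomputable def schrodingerSymbol (s p : ℝ) : ℂ := Complex.exp (Complex.I * ((s * p ^ 2 : ℝ) : ℂ))

theorem hasTemperateGrowth_schrodingerSymbol (s : ℝ) :
    Function.HasTemperateGrowth (schrodingerSymbol s) := by
  have h : Function.HasTemperateGrowth fun p : ℝ => s * p ^ 2 :=
    (Function.HasTemperateGrowth.const s).mul (Function.HasTemperateGrowth.id'.pow 2)
  exact hasTemperateGrowth_cexp_I_mul.comp h

/-- Multiplication by `p ↦ e^{isp²}` on Schwartz space: the free Schrödinger evolution on the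
Fourier side. -/
noncomputable def symbolMul (s : ℝ) : 𝓢(ℝ, ℂ) →L[ℂ] 𝓢(ℝ, ℂ) :=
  SchwartzMap.smulLeftCLM ℂ (schrodingerSymbol s)

/-- Multiplication by the variable on Schwartz space. -/
noncomputable def varMul : 𝓢(ℝ, ℂ) →L[ℂ] 𝓢(ℝ, ℂ) :=
  SchwartzMap.smulLeftCLM ℂ (fun p : ℝ => (p : ℂ))

theorem symbolMul_apply (s : ℝ) (φ : 𝓢(ℝ, ℂ)) (p : ℝ) :
    symbolMul s φ p = schrodingerSymbol s p * φ p := by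
  rw [symbolMul, SchwartzMap.smulLeftCLM_apply_apply (hasTemperateGrowth_schrodingerSymbol s),
    smul_eq_mul]

theorem varMul_apply (φ : 𝓢(ℝ, ℂ)) (p : ℝ) : varMul φ p = p * φ p := by
  rw [varMul, SchwartzMap.smulLeftCLM_apply_apply Function.Complex.hasTemperateGrowth_ofReal,
    smul_eq_mul]

theorem symbolMul_add (s h : ℝ) (φ : 𝓢(ℝ, ℂ)) :
    symbolMul (s + h) φ = symbolMul s (symbolMul h φ) := by
  ext p
  simp only [symbolMul_apply, schrodingerSymbol, ← mul_assoc, ← Complex.exp_add]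
  congr 2
  push_cast
  ring

theorem symbolMul_zero (φ : 𝓢(ℝ, ℂ)) : symbolMul 0 φ = φ := by
  ext p
  simp [symbolMul_apply, schrodingerSymbol]

theorem hasDerivAt_schrodingerSymbol (s p : ℝ) :
    HasDerivAt (schrodingerSymbol s) (schrodingerSymbol s p * (Complex.I * (2 * s * p))) p := by
  have h : HasDerivAt (fun p : ℝ => s * p ^ 2) (s * (2 * p)) p := by
    simpa using (hasDerivAt_pow 2 p).const_mul s
  refine ((h.ofReal_comp.const_mul Complex.I).cexp).congr_deriv ?_
  rw [schrodingerSymbol]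
  push_cast
  ring

theorem derivCLM_symbolMul (s : ℝ) (φ : 𝓢(ℝ, ℂ)) :
    SchwartzMap.derivCLM ℂ ℂ (symbolMul s φ) =
      symbolMul s (SchwartzMap.derivCLM ℂ ℂ φ) + (2 * Complex.I * s) • symbolMul s (varMul φ) := by
  ext p
  have h : HasDerivAt (symbolMul s φ) _ p :=
    ((hasDerivAt_schrodingerSymbol s p).mul (φ.hasDerivAt p)).congr_of_eventuallyEq
      (.of_forall fun q => symbolMul_apply s φ q)
  simp only [SchwartzMap.derivCLM_apply, h.deriv, add_apply, smul_apply,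
    symbolMul_apply, varMul_apply, smul_eq_mul]
  ring

theorem derivCLM_varMul (φ : 𝓢(ℝ, ℂ)) :
    SchwartzMap.derivCLM ℂ ℂ (varMul φ) = φ + varMul (SchwartzMap.derivCLM ℂ ℂ φ) := by
  ext p
  have h : HasDerivAt (varMul φ) _ p :=
    ((Complex.ofRealCLM.hasDerivAt (x := p)).mul (φ.hasDerivAt p)).congr_of_eventuallyEq
      (.of_forall fun q => varMul_apply φ q)
  simp [SchwartzMap.derivCLM_apply, h.deriv, varMul_apply]

theorem seminorm_succ_le (k n : ℕ) (f : 𝓢(ℝ, ℂ)) :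
    SchwartzMap.seminorm ℂ k (n + 1) f ≤ SchwartzMap.seminorm ℂ k n (SchwartzMap.derivCLM ℂ ℂ f) := by
  refine SchwartzMap.seminorm_le_bound' ℂ k (n + 1) f (apply_nonneg _ _) fun x => ?_
  have h := SchwartzMap.le_seminorm' ℂ k n (SchwartzMap.derivCLM ℂ ℂ f) x
  rw [iteratedDeriv_succ']
  exact h

/-- Continuity of `h ↦ e^{ihp²} φ` at `h = 0`, seminorm by seminorm. The induction on the number of
derivatives uses `derivCLM_symbolMul`. -/
theorem exists_seminorm_symbolMul_sub_le (k n : ℕ) (φ : 𝓢(ℝ, ℂ)) :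
    ∃ C, 0 ≤ C ∧ ∀ h : ℝ, |h| ≤ 1 → SchwartzMap.seminorm ℂ k n (symbolMul h φ - φ) ≤ C * |h| := by
  induction n generalizing φ with
  | zero =>
    refine ⟨SchwartzMap.seminorm ℂ k 0 (varMul (varMul φ)), apply_nonneg _ _, fun h hh => ?_⟩
    refine SchwartzMap.seminorm_le_bound' ℂ k 0 _ (by positivity) fun x => ?_
    have h1 := SchwartzMap.le_seminorm' ℂ k 0 (varMul (varMul φ)) x
    have h2 : ‖schrodingerSymbol h x - 1‖ ≤ |h| * x ^ 2 := by
      refine (Real.norm_exp_I_mul_ofReal_sub_one_le (x := h * x ^ 2)).trans_eq ?_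
      rw [Real.norm_eq_abs, abs_mul, abs_of_nonneg (sq_nonneg x)]
    simp only [iteratedDeriv_zero, varMul_apply, norm_mul, Complex.norm_real, Real.norm_eq_abs] at h1
    rw [iteratedDeriv_zero, sub_apply, symbolMul_apply,
      show schrodingerSymbol h x * φ x - φ x = (schrodingerSymbol h x - 1) * φ x by ring, norm_mul]
    calc |x| ^ k * (‖schrodingerSymbol h x - 1‖ * ‖φ x‖)
        ≤ |x| ^ k * (|h| * x ^ 2 * ‖φ x‖) := by gcongr
      _ = |x| ^ k * (|x| * (|x| * ‖φ x‖)) * |h| := by rw [← sq_abs]; ring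
      _ ≤ _ := by gcongr
  | succ n ih =>
    obtain ⟨C₁, hC₁, h₁⟩ := ih (SchwartzMap.derivCLM ℂ ℂ φ)
    obtain ⟨C₂, hC₂, h₂⟩ := ih (varMul φ)
    refine ⟨C₁ + 2 * (C₂ + SchwartzMap.seminorm ℂ k n (varMul φ)), by positivity, fun h hh => ?_⟩
    have heq : SchwartzMap.derivCLM ℂ ℂ (symbolMul h φ - φ) =
        (symbolMul h (SchwartzMap.derivCLM ℂ ℂ φ) - SchwartzMap.derivCLM ℂ ℂ φ) +
          (2 * Complex.I * h) • ((symbolMul h (varMul φ) - varMul φ) + varMul φ) := by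
      rw [map_sub, derivCLM_symbolMul, sub_add_cancel]
      abel
    refine (seminorm_succ_le k n _).trans ?_
    rw [heq]
    refine (map_add_le_add _ _ _).trans ?_
    rw [map_smul_eq_mul]
    have h3 := map_add_le_add (SchwartzMap.seminorm ℂ k n) (symbolMul h (varMul φ) - varMul φ)
      (varMul φ)
    have h4 : SchwartzMap.seminorm ℂ k n (symbolMul h (varMul φ) - varMul φ) ≤ C₂ :=
      (h₂ h hh).trans (mul_le_of_le_one_right hC₂ hh)
    have h5 : ‖2 * Complex.I * (h : ℂ)‖ = 2 * |h| := by simp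
    rw [h5]
    have h6 := h₁ h hh
    have h7 := mul_le_mul_of_nonneg_left (h3.trans (add_le_add_left h4 _)) (abs_nonneg h)
    linarith

/-- First order Taylor expansion of `h ↦ e^{ihp²} φ` at `h = 0`, seminorm by seminorm. -/
theorem exists_seminorm_symbolMul_sub_sub_le (k n : ℕ) (φ : 𝓢(ℝ, ℂ)) :
    ∃ C, 0 ≤ C ∧ ∀ h : ℝ, |h| ≤ 1 → SchwartzMap.seminorm ℂ k n
      (symbolMul h φ - φ - (Complex.I * h) • varMul (varMul φ)) ≤ C * h ^ 2 := by
  induction n generalizing φ with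
  | zero =>
    refine ⟨2 * SchwartzMap.seminorm ℂ k 0 (varMul (varMul (varMul (varMul φ)))), by positivity,
      fun h hh => ?_⟩
    refine SchwartzMap.seminorm_le_bound' ℂ k 0 _ (by positivity) fun x => ?_
    have h1 := SchwartzMap.le_seminorm' ℂ k 0 (varMul (varMul (varMul (varMul φ)))) x
    have h2 : ∀ θ : ℝ, ‖Complex.exp (Complex.I * θ) - 1 - Complex.I * θ‖ ≤ 2 * θ ^ 2 := by
      intro θ
      have hn : ‖Complex.I * (θ : ℂ)‖ = |θ| := by simp
      rcases le_total |θ| 1 with hθ | hθ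
      · have := Complex.norm_exp_sub_one_sub_id_le (x := Complex.I * θ) (by rwa [hn])
        rw [hn, sq_abs] at this
        nlinarith [sq_nonneg θ]
      -- for large `θ` the three terms are estimated separately
      · refine (norm_sub_le _ _).trans ?_
        have := Real.norm_exp_I_mul_ofReal_sub_one_le (x := θ)
        rw [Real.norm_eq_abs] at this
        rw [hn, ← sq_abs]
        nlinarith
    have h3 := h2 (h * x ^ 2)
    simp only [iteratedDeriv_zero, varMul_apply, norm_mul, Complex.norm_real, Real.norm_eq_abs] at h1
    rw [iteratedDeriv_zero, sub_apply, sub_apply, smul_apply, symbolMul_apply, varMul_apply,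
      varMul_apply, smul_eq_mul,
      show schrodingerSymbol h x * φ x - φ x - Complex.I * h * (x * (x * φ x)) =
        (Complex.exp (Complex.I * ((h * x ^ 2 : ℝ) : ℂ)) - 1 -
          Complex.I * ((h * x ^ 2 : ℝ) : ℂ)) * φ x by
        rw [schrodingerSymbol]; push_cast; ring, norm_mul]
    calc |x| ^ k * (‖Complex.exp (Complex.I * ((h * x ^ 2 : ℝ) : ℂ)) - 1 -
          Complex.I * ((h * x ^ 2 : ℝ) : ℂ)‖ * ‖φ x‖)
        ≤ |x| ^ k * (2 * (h * x ^ 2) ^ 2 * ‖φ x‖) := by gcongr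
      _ = 2 * (|x| ^ k * (|x| * (|x| * (|x| * (|x| * ‖φ x‖))))) * h ^ 2 := by
        rw [← sq_abs x]; ring
      _ ≤ _ := by gcongr
  | succ n ih =>
    obtain ⟨C₁, hC₁, h₁⟩ := ih (SchwartzMap.derivCLM ℂ ℂ φ)
    obtain ⟨C₂, hC₂, h₂⟩ := exists_seminorm_symbolMul_sub_le k n (varMul φ)
    refine ⟨C₁ + 2 * C₂, by positivity, fun h hh => ?_⟩
    have heq : SchwartzMap.derivCLM ℂ ℂ (symbolMul h φ - φ - (Complex.I * h) • varMul (varMul φ)) =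
        (symbolMul h (SchwartzMap.derivCLM ℂ ℂ φ) - SchwartzMap.derivCLM ℂ ℂ φ -
          (Complex.I * h) • varMul (varMul (SchwartzMap.derivCLM ℂ ℂ φ))) +
          (2 * Complex.I * h) • (symbolMul h (varMul φ) - varMul φ) := by
      rw [map_sub, map_sub, derivCLM_symbolMul, map_smul, derivCLM_varMul, derivCLM_varMul, map_add]
      module
    refine (seminorm_succ_le k n _).trans ?_
    rw [heq]
    refine (map_add_le_add _ _ _).trans ?_
    rw [map_smul_eq_mul]
    have h5 : ‖2 * Complex.I * (h : ℂ)‖ = 2 * |h| := by simp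
    rw [h5]
    have h6 := h₁ h hh
    have h7 := mul_le_mul_of_nonneg_left (h₂ h hh) (abs_nonneg h)
    have h8 := sq_abs h
    nlinarith

theorem tendsto_symbolMul_zero (φ : 𝓢(ℝ, ℂ)) :
    Tendsto (fun h : ℝ => symbolMul h φ) (𝓝 0) (𝓝 φ) := by
  rw [(schwartz_withSeminorms ℂ ℝ ℂ).tendsto_nhds]
  rintro ⟨k, n⟩ ε hε
  obtain ⟨C, hC, h⟩ := exists_seminorm_symbolMul_sub_le k n φ
  have h1 : Tendsto (fun h : ℝ => C * |h|) (𝓝 0) (𝓝 0) :=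
    (by fun_prop : Continuous fun h : ℝ => C * |h|).tendsto' 0 0 (by simp)
  filter_upwards [h1.eventually (gt_mem_nhds hε), Metric.closedBall_mem_nhds (0 : ℝ) one_pos]
    with t ht ht1
  exact (h t (by simpa using ht1)).trans_lt ht

/-- The evolution `h ↦ e^{ihp²} φ` is differentiable at `0` in the topology of Schwartz space. -/
theorem tendsto_slope_symbolMul_zero (φ : 𝓢(ℝ, ℂ)) :
    Tendsto (fun h : ℝ => ((h⁻¹ : ℝ) : ℂ) • (symbolMul h φ - φ)) (𝓝[≠] 0)
      (𝓝 (Complex.I • varMul (varMul φ))) := by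
  rw [(schwartz_withSeminorms ℂ ℝ ℂ).tendsto_nhds]
  rintro ⟨k, n⟩ ε hε
  obtain ⟨C, hC, h⟩ := exists_seminorm_symbolMul_sub_sub_le k n φ
  have h1 : Tendsto (fun h : ℝ => C * |h|) (𝓝 0) (𝓝 0) :=
    (by fun_prop : Continuous fun h : ℝ => C * |h|).tendsto' 0 0 (by simp)
  filter_upwards [nhdsWithin_le_nhds (h1.eventually (gt_mem_nhds hε)),
    nhdsWithin_le_nhds (Metric.closedBall_mem_nhds (0 : ℝ) one_pos), self_mem_nhdsWithin]
    with t ht ht1 ht0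
  have ht0 : t ≠ 0 := ht0
  have heq : ((t⁻¹ : ℝ) : ℂ) • (symbolMul t φ - φ) - Complex.I • varMul (varMul φ) =
      ((t⁻¹ : ℝ) : ℂ) • (symbolMul t φ - φ - (Complex.I * t) • varMul (varMul φ)) := by
    rw [smul_sub _ (symbolMul t φ - φ), smul_smul]
    congr 2
    have : (t : ℂ) ≠ 0 := by exact_mod_cast ht0
    push_cast
    field_simp
  rw [heq, SchwartzMap.schwartzSeminormFamily_apply, map_smul_eq_mul, Complex.norm_real, norm_inv,
    Real.norm_eq_abs]
  have h2 := h t (by simpa using ht1)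
  have h3 : 0 < |t| := abs_pos.2 ht0
  refine lt_of_le_of_lt ?_ ht
  calc |t|⁻¹ * _ ≤ |t|⁻¹ * (C * t ^ 2) := by gcongr
    _ = C * |t| := by rw [← sq_abs]; field_simp

theorem continuous_symbolMul (φ : 𝓢(ℝ, ℂ)) : Continuous fun s => symbolMul s φ := by
  rw [continuous_iff_continuousAt]
  intro s
  have h1 : Tendsto (fun r : ℝ => symbolMul s (symbolMul (r - s) φ)) (𝓝 s) (𝓝 (symbolMul s φ)) := by
    refine ((symbolMul s).continuous.tendsto φ).comp ((tendsto_symbolMul_zero φ).comp ?_)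
    exact (by fun_prop : Continuous fun r : ℝ => r - s).tendsto' s 0 (sub_self s)
  refine h1.congr fun r => ?_
  rw [← symbolMul_add, add_sub_cancel]

/-! ### Uniqueness and the integral formula for the solution -/

theorem derivCLM_schwartzFourier (φ : 𝓢(ℝ, ℂ)) :
    SchwartzMap.derivCLM ℂ ℂ (schwartzFourier φ) =
      (-Complex.I) • schwartzFourier (varMul φ) := by
  have happ : ∀ (ψ : 𝓢(ℝ, ℂ)) (p : ℝ), schwartzFourier ψ p = 𝓕 (ψ : ℝ → ℂ) (p * (2 * Real.pi)⁻¹) :=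
    fun _ _ => rfl
  ext p
  have hint : Integrable (fun x : ℝ => x • φ x) := by
    refine (varMul φ).integrable.congr (.of_forall fun x => ?_)
    simp only [varMul_apply, Complex.real_smul]
  have h1 := Real.hasDerivAt_fourier φ.integrable hint (p * (2 * Real.pi)⁻¹)
  have h2 : HasDerivAt (schwartzFourier φ) _ p :=
    (h1.scomp p ((hasDerivAt_id p).mul_const (2 * Real.pi)⁻¹)).congr_of_eventuallyEq
      (.of_forall fun q => happ φ q)
  have h3 : (fun x : ℝ => (-2 * Real.pi * Complex.I * x : ℂ) • φ x) =
      fun x : ℝ => (-2 * Real.pi * Complex.I : ℂ) • (varMul φ) x := by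
    funext x
    rw [varMul_apply, smul_eq_mul, smul_eq_mul]
    ring
  rw [SchwartzMap.derivCLM_apply, h2.deriv, h3, smul_apply, happ,
    show 𝓕 (fun x : ℝ => (-2 * Real.pi * Complex.I : ℂ) • (varMul φ) x) (p * (2 * Real.pi)⁻¹) =
      (-2 * Real.pi * Complex.I : ℂ) • 𝓕 (varMul φ : ℝ → ℂ) (p * (2 * Real.pi)⁻¹) by
      simp only [Real.fourier_real_eq, ← integral_smul]
      refine integral_congr_ae (.of_forall fun x => ?_)
      simp only [Circle.smul_def, smul_eq_mul]
      ring]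
  have hpi : (Real.pi : ℂ) ≠ 0 := by exact_mod_cast Real.pi_ne_zero
  simp only [one_mul, Complex.real_smul, smul_eq_mul]
  push_cast
  field_simp

theorem derivCLM_derivCLM_schwartzFourier (φ : 𝓢(ℝ, ℂ)) :
    SchwartzMap.derivCLM ℂ ℂ (SchwartzMap.derivCLM ℂ ℂ (schwartzFourier φ)) =
      -schwartzFourier (varMul (varMul φ)) := by
  rw [derivCLM_schwartzFourier, map_smul, derivCLM_schwartzFourier, smul_smul]
  simp

/-- Pairing a solution with a test function that follows the adjoint evolution gives a quantity which
does not change in time. The joint continuity of the pairing is what allows the product rule. -/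
theorem hasDerivAt_pairing_schwartzFourier_symbolMul {v : ℝ → 𝓢'(ℝ, ℂ)}
    (hv : ContinuousOn (fun q : ℝ × 𝓢(ℝ, ℂ) => v q.1 q.2) (Ici 0 ×ˢ univ))
    (hd : ∀ t : ℝ, 0 < t → ∀ φ : 𝓢(ℝ, ℂ), HasDerivAt (fun s : ℝ => v s φ)
      (Complex.I * TemperedDistribution.derivCLM ℂ (TemperedDistribution.derivCLM ℂ (v t)) φ) t)
    (φ : 𝓢(ℝ, ℂ)) {s : ℝ} (hs : 0 < s) :
    HasDerivAt (fun s => v s (schwartzFourier (symbolMul s φ))) 0 s := by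
  have h1 := hasDerivAt_iff_tendsto_slope_zero.1 (hd s hs (schwartzFourier (symbolMul s φ)))
  have h2 : Tendsto (fun h : ℝ => v (s + h) (schwartzFourier (symbolMul s
      (((h⁻¹ : ℝ) : ℂ) • (symbolMul h φ - φ))))) (𝓝[≠] 0)
      (𝓝 (v s (schwartzFourier (symbolMul s (Complex.I • varMul (varMul φ)))))) := by
    have hc : ContinuousAt (fun q : ℝ × 𝓢(ℝ, ℂ) => v q.1 q.2)
        (s, schwartzFourier (symbolMul s (Complex.I • varMul (varMul φ)))) :=
      hv.continuousAt (prod_mem_nhds (Ici_mem_nhds hs) univ_mem)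
    refine hc.tendsto.comp (Tendsto.prodMk_nhds (f := 𝓝[≠] (0 : ℝ)) (mx := fun h : ℝ => s + h) ?_ ?_)
    · exact ((by fun_prop : Continuous fun h : ℝ => s + h).tendsto' 0 s (add_zero s)).mono_left
        nhdsWithin_le_nhds
    · exact ((schwartzFourier.continuous.comp (symbolMul s).continuous).tendsto _).comp
        (tendsto_slope_symbolMul_zero φ)
  rw [hasDerivAt_iff_tendsto_slope_zero]
  -- the two contributions to the derivative, of the test function and of `v`, cancel
  have hlim : v s (schwartzFourier (symbolMul s (Complex.I • varMul (varMul φ)))) +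
      Complex.I * TemperedDistribution.derivCLM ℂ (TemperedDistribution.derivCLM ℂ (v s))
        (schwartzFourier (symbolMul s φ)) = 0 := by
    have hcomm : varMul (varMul (symbolMul s φ)) = symbolMul s (varMul (varMul φ)) := by
      ext p
      simp only [varMul_apply, symbolMul_apply]
      ring
    rw [TemperedDistribution.derivCLM_apply_apply, TemperedDistribution.derivCLM_apply_apply,
      map_neg, map_neg, map_neg, neg_neg, derivCLM_derivCLM_schwartzFourier, hcomm]
    simp only [map_smul, map_neg, smul_eq_mul]
    ring
  have h3 := h2.add h1
  rw [hlim] at h3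
  refine h3.congr fun h => ?_
  rw [symbolMul_add]
  simp only [map_smul, map_sub, Complex.real_smul, smul_eq_mul]
  ring

/-- Conservation up to the initial time: this determines every solution. -/
theorem pairing_schwartzFourier_symbolMul_eq {v : ℝ → 𝓢'(ℝ, ℂ)}
    (hv : ContinuousOn (fun q : ℝ × 𝓢(ℝ, ℂ) => v q.1 q.2) (Ici 0 ×ˢ univ))
    (hd : ∀ t : ℝ, 0 < t → ∀ φ : 𝓢(ℝ, ℂ), HasDerivAt (fun s : ℝ => v s φ)
      (Complex.I * TemperedDistribution.derivCLM ℂ (TemperedDistribution.derivCLM ℂ (v t)) φ) t)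
    (φ : 𝓢(ℝ, ℂ)) {t : ℝ} (ht : 0 < t) :
    v t (schwartzFourier (symbolMul t φ)) = v 0 (schwartzFourier φ) := by
  have hG := fun s hs => hasDerivAt_pairing_schwartzFourier_symbolMul hv hd φ (s := s) hs
  have hconst : ∀ s ∈ Ioi (0 : ℝ), v s (schwartzFourier (symbolMul s φ)) =
      v t (schwartzFourier (symbolMul t φ)) := fun s hs =>
    isOpen_Ioi.is_const_of_deriv_eq_zero isPreconnected_Ioi
      (fun r hr => (hG r hr).differentiableAt.differentiableWithinAt) (fun r hr => (hG r hr).deriv)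
      hs ht
  have hcont : ContinuousWithinAt (fun s => v s (schwartzFourier (symbolMul s φ))) (Ici 0) 0 := by
    have h1 : ContinuousWithinAt (fun q : ℝ × 𝓢(ℝ, ℂ) => v q.1 q.2) (Ici 0 ×ˢ univ)
        (0, schwartzFourier (symbolMul 0 φ)) := hv _ ⟨self_mem_Ici, mem_univ _⟩
    refine ContinuousWithinAt.comp (f := fun s : ℝ => (s, schwartzFourier (symbolMul s φ)))
      (g := fun q : ℝ × 𝓢(ℝ, ℂ) => v q.1 q.2) h1 ?_ (fun s hs => ⟨hs, mem_univ _⟩)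
    exact (continuous_id.prodMk (schwartzFourier.continuous.comp
      (continuous_symbolMul φ))).continuousWithinAt
  have h1 : Tendsto (fun s => v s (schwartzFourier (symbolMul s φ))) (𝓝[>] 0)
      (𝓝 (v 0 (schwartzFourier (symbolMul 0 φ)))) :=
    hcont.tendsto.mono_left (nhdsWithin_mono _ Ioi_subset_Ici_self)
  rw [symbolMul_zero] at h1
  exact tendsto_nhds_unique (tendsto_const_nhds.congr'
    (eventually_mem_nhdsWithin.mono fun s hs => (hconst s hs).symm)) h1

/-- Fourier inversion for `schwartzFourier`. -/
theorem exists_schwartzFourier_eq (ψ : 𝓢(ℝ, ℂ)) : ∃ φ : 𝓢(ℝ, ℂ), schwartzFourier φ = ψ ∧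
    ∀ p : ℝ, φ p = (2 * Real.pi)⁻¹ * ∫ x : ℝ, ψ x * Complex.exp (Complex.I * x * p) := by
  have h2pi : (2 * Real.pi) ≠ 0 := Real.two_pi_pos.ne'
  let e := ContinuousLinearEquiv.unitsEquivAut ℝ (Units.mk0 (2 * Real.pi) h2pi)
  let ψ' : 𝓢(ℝ, ℂ) := SchwartzMap.compCLMOfContinuousLinearEquiv ℂ e ψ
  have hψ' : ∀ y, ψ' y = ψ (y * (2 * Real.pi)) := fun y => rfl
  refine ⟨𝓕⁻ ψ', ?_, fun p => ?_⟩
  · ext p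
    have : schwartzFourier (𝓕⁻ ψ') p = 𝓕 (𝓕⁻ ψ') (p * (2 * Real.pi)⁻¹) := rfl
    rw [this, FourierTransform.fourier_fourierInv_eq, hψ', inv_mul_cancel_right₀ h2pi]
  · rw [SchwartzMap.fourierInv_coe, Real.fourierInv_eq']
    have h := Measure.integral_comp_mul_right
      (fun x : ℝ => ψ x * Complex.exp (Complex.I * x * p)) (2 * Real.pi)
    rw [abs_of_pos (inv_pos.2 Real.two_pi_pos), Complex.real_smul] at h
    push_cast at h ⊢
    rw [← h]
    refine integral_congr_ae (.of_forall fun x => ?_)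
    simp only [hψ', smul_eq_mul]
    rw [mul_comm]
    congr 2
    simp only [RCLike.inner_apply, conj_trivial]
    push_cast
    ring

/-- The solution of the free Schrödinger equation as an oscillatory integral. -/
theorem IsSolution.eq_integral {u₀ : 𝓢'(ℝ, ℂ)} {u : ℝ → ℝ → ℂ} (hu : IsSolution u₀ u) {U : ℝ → ℂ}
    (hU : IsGivenBy (fourier u₀) U) (hUi : Integrable U) {t : ℝ} (ht : 0 < t) (x : ℝ) :
    u t x = (2 * Real.pi : ℂ)⁻¹ *
      ∫ p, U p * Complex.exp (Complex.I * ((-t * p ^ 2 + x * p : ℝ) : ℂ)) := by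
  obtain ⟨v, hv0, hv, hd, hvu⟩ := hu
  obtain ⟨hucont, hgiven⟩ := hvu t ht
  have hexpn : ∀ θ : ℝ, ‖Complex.exp (Complex.I * (θ : ℂ))‖ = 1 := fun θ => by
    rw [Complex.norm_exp]; simp
  set g : ℝ → ℂ := fun x => (2 * Real.pi : ℂ)⁻¹ *
      ∫ p, U p * Complex.exp (Complex.I * ((-t * p ^ 2 + x * p : ℝ) : ℂ)) with hg
  have hgcont : Continuous g := by
    refine continuous_const.mul (continuous_of_dominated (bound := fun p => ‖U p‖) (fun x => ?_)
      (fun x => .of_forall fun p => ?_) hUi.norm (.of_forall fun p => by fun_prop))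
    · exact hUi.aestronglyMeasurable.mul (Continuous.aestronglyMeasurable (by fun_prop))
    · rw [norm_mul, hexpn, mul_one]
  have hpair : ∀ ψ : 𝓢(ℝ, ℂ), ∫ x, u t x * ψ x = ∫ x, g x * ψ x := by
    intro ψ
    obtain ⟨φ, hφ, hφp⟩ := exists_schwartzFourier_eq ψ
    -- the test function is moved back by time `t`, so that it is `φ` at time `t`
    have h1 := pairing_schwartzFourier_symbolMul_eq hv hd (symbolMul (-t) φ) ht
    rw [← symbolMul_add, add_neg_cancel, symbolMul_zero, hφ, hv0, (hgiven ψ).2, ← fourier_apply,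
      (hU _).2] at h1
    rw [h1]
    have hfub : Integrable (fun q : ℝ × ℝ => (2 * Real.pi : ℂ)⁻¹ *
        (U q.1 * ψ q.2) * Complex.exp (Complex.I * ((-t * q.1 ^ 2 + q.2 * q.1 : ℝ) : ℂ)))
        (volume.prod volume) := by
      refine ((hUi.mul_prod ψ.integrable).const_mul _).mul_bdd (c := 1)
        (Continuous.aestronglyMeasurable (by fun_prop)) (.of_forall fun q => (hexpn _).le)
    calc ∫ p, U p * symbolMul (-t) φ p
        = ∫ p, ∫ x, (2 * Real.pi : ℂ)⁻¹ * (U p * ψ x) *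
            Complex.exp (Complex.I * ((-t * p ^ 2 + x * p : ℝ) : ℂ)) := by
          refine integral_congr_ae (.of_forall fun p => ?_)
          simp only [symbolMul_apply, hφp, schrodingerSymbol]
          rw [← mul_assoc, ← mul_assoc, ← integral_const_mul]
          refine integral_congr_ae (.of_forall fun x => ?_)
          simp only
          have : Complex.exp (Complex.I * ((-t * p ^ 2 + x * p : ℝ) : ℂ)) =
              Complex.exp (Complex.I * ((-t * p ^ 2 : ℝ) : ℂ)) * Complex.exp (Complex.I * x * p) := by
            rw [← Complex.exp_add]; congr 1; push_cast; ring
          rw [this]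
          push_cast
          ring
      _ = ∫ x, ∫ p, (2 * Real.pi : ℂ)⁻¹ * (U p * ψ x) *
            Complex.exp (Complex.I * ((-t * p ^ 2 + x * p : ℝ) : ℂ)) := integral_integral_swap hfub
      _ = ∫ x, g x * ψ x := by
          refine integral_congr_ae (.of_forall fun x => ?_)
          simp only [hg]
          rw [mul_assoc, ← integral_mul_const, ← integral_const_mul]
          refine integral_congr_ae (.of_forall fun p => ?_)
          simp only
          ring
  have hae : ∀ᵐ x, u t x = g x := by
    refine ae_eq_of_integral_contDiff_smul_eq hucont.locallyIntegrable hgcont.locallyIntegrable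
      fun f hf hfc => ?_
    have hc : HasCompactSupport fun x => (f x : ℂ) := hfc.comp_left Complex.ofReal_zero
    have := hpair (hc.toSchwartzMap (Complex.ofRealCLM.contDiff.comp hf))
    simp only [Complex.real_smul]
    simp_rw [mul_comm (f _ : ℂ)]
    exact this
  exact congr_fun (Continuous.ae_eq_iff_eq volume hucont hgcont |>.1 hae) x

/-! ### Integration by parts for oscillatory integrals -/

/-- Integration by parts against a derivative `v'` with `‖v‖ ≤ 1`. The derivative of `u` is only needed
on the open interval and may blow up at the ends as long as it has an integrable majorant `B`: at
the singular endpoint `B` is a multiple of `s ^ (μ - 1)`. -/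
theorem norm_integral_mul_deriv_le {a b : ℝ} (hab : a ≤ b) {u v u' v' : ℝ → ℂ} {B : ℝ → ℝ}
    (hu : ContinuousOn u (Icc a b)) (hv : ContinuousOn v (Icc a b))
    (hu' : ∀ x ∈ Ioo a b, HasDerivAt u (u' x) x) (hv' : ∀ x ∈ Ioo a b, HasDerivAt v (v' x) x)
    (hu'c : ContinuousOn u' (Ioo a b)) (hv'i : IntervalIntegrable v' volume a b)
    (hB : IntervalIntegrable B volume a b) (hle : ∀ x ∈ Ioo a b, ‖u' x‖ ≤ B x)
    (hv1 : ∀ x ∈ Icc a b, ‖v x‖ ≤ 1) :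
    ‖∫ x in a..b, u x * v' x‖ ≤ ‖u a‖ + ‖u b‖ + ∫ x in a..b, B x := by
  have hu'i : IntervalIntegrable u' volume a b := by
    rw [intervalIntegrable_iff_integrableOn_Ioo_of_le hab] at hB ⊢
    exact hB.mono' (hu'c.aestronglyMeasurable measurableSet_Ioo)
      ((ae_restrict_iff' measurableSet_Ioo).2 (.of_forall hle))
  rw [intervalIntegral.integral_mul_deriv_eq_deriv_mul_of_hasDerivAt (by rwa [uIcc_of_le hab])
    (by rwa [uIcc_of_le hab]) (by simpa [hab] using hu') (by simpa [hab] using hv') hu'i hv'i]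
  have h1 : ‖∫ x in a..b, u' x * v x‖ ≤ ∫ x in a..b, B x := by
    refine intervalIntegral.norm_integral_le_of_norm_le hab ?_ hB
    have : ∀ᵐ x : ℝ, x ≠ b := by simp [ae_iff, measure_singleton]
    filter_upwards [this] with x hxb hx
    have h2 := hle x ⟨hx.1, lt_of_le_of_ne hx.2 hxb⟩
    rw [norm_mul]
    exact (mul_le_of_le_one_right (norm_nonneg _) (hv1 x ⟨hx.1.le, hx.2⟩)).trans h2
  have h3 : ‖u b * v b‖ ≤ ‖u b‖ := by
    rw [norm_mul]; exact mul_le_of_le_one_right (norm_nonneg _) (hv1 b ⟨hab, le_rfl⟩)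
  have h4 : ‖u a * v a‖ ≤ ‖u a‖ := by
    rw [norm_mul]; exact mul_le_of_le_one_right (norm_nonneg _) (hv1 a ⟨le_rfl, hab⟩)
  linarith [norm_sub_le (u b * v b - u a * v a) (∫ x in a..b, u' x * v x),
    norm_sub_le (u b * v b) (u a * v a)]

/-- For a nonnegative decreasing weight the total variation is at most the initial value. -/
theorem norm_integral_antitone_mul_deriv_le {a b : ℝ} (hab : a ≤ b) {g g' : ℝ → ℝ} {v v' : ℝ → ℂ}
    (hg : ∀ x ∈ Icc a b, HasDerivAt g (g' x) x) (hg'c : ContinuousOn g' (Icc a b))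
    (hg' : ∀ x ∈ Icc a b, g' x ≤ 0) (hg0 : 0 ≤ g b)
    (hv : ∀ x ∈ Icc a b, HasDerivAt v (v' x) x) (hv'c : ContinuousOn v' (Icc a b))
    (hv1 : ∀ x ∈ Icc a b, ‖v x‖ ≤ 1) :
    ‖∫ x in a..b, (g x : ℂ) * v' x‖ ≤ 2 * g a := by
  have hint : IntervalIntegrable g' volume a b :=
    (by rwa [uIcc_of_le hab] : ContinuousOn g' (uIcc a b)).intervalIntegrable
  have hi : ∫ x in a..b, g' x = g b - g a :=
    intervalIntegral.integral_eq_sub_of_hasDerivAt (by simpa [hab] using hg) hint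
  have hga : g b ≤ g a := by
    have : ∫ x in a..b, g' x ≤ ∫ x in a..b, (0 : ℝ) :=
      intervalIntegral.integral_mono_on hab hint (by simp) hg'
    simp only [intervalIntegral.integral_zero] at this
    linarith
  have h := norm_integral_mul_deriv_le (u := fun x => (g x : ℂ)) (u' := fun x => (g' x : ℂ))
    (B := fun x => -g' x) hab
    (fun x hx => (hg x hx).ofReal_comp.continuousAt.continuousWithinAt)
    (fun x hx => (hv x hx).continuousAt.continuousWithinAt)
    (fun x hx => (hg x (Ioo_subset_Icc_self hx)).ofReal_comp)
    (fun x hx => hv x (Ioo_subset_Icc_self hx))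
    (Complex.continuous_ofReal.comp_continuousOn (hg'c.mono Ioo_subset_Icc_self))
    (by rwa [uIcc_of_le hab] : ContinuousOn v' (uIcc a b)).intervalIntegrable hint.neg
    (fun x hx => by
      rw [Complex.norm_real, Real.norm_of_nonpos (hg' x (Ioo_subset_Icc_self hx))]) hv1
  rw [intervalIntegral.integral_neg, hi, Complex.norm_real, Complex.norm_real,
    Real.norm_of_nonneg hg0, Real.norm_of_nonneg (hg0.trans hga)] at h
  linarith

/-- A tail bound that is uniform up to the purely oscillatory case `b.re = 0`. -/
theorem norm_integral_gaussian_tail_le {b : ℂ} (hb : 0 ≤ b.re) (hb0 : b ≠ 0) {B R : ℝ} (hB : 0 < B)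
    (hBR : B ≤ R) : ‖∫ y in B..R, Complex.exp (-b * (y : ℂ) ^ 2)‖ ≤ 1 / (‖b‖ * B) := by
  have hpos : ∀ x ∈ Icc B R, 0 < x := fun x hx => hB.trans_le hx.1
  have h := norm_integral_antitone_mul_deriv_le (g := fun y => y⁻¹) (g' := fun y => -(y ^ 2)⁻¹)
    (v := fun y => Complex.exp (-b * (y : ℂ) ^ 2))
    (v' := fun y => Complex.exp (-b * (y : ℂ) ^ 2) * (-b * (2 * (y : ℂ)))) hBR
    (fun x hx => hasDerivAt_inv (hpos x hx).ne')
    (ContinuousOn.neg (ContinuousOn.inv₀ (by fun_prop) fun x hx => pow_ne_zero 2 (hpos x hx).ne'))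
    (fun x hx => by have := hpos x hx; simp; positivity)
    (inv_nonneg.2 (hpos R ⟨hBR, le_rfl⟩).le)
    (fun x hx => by
      have h1 : HasDerivAt (fun y : ℝ => (y : ℂ) ^ 2) (2 * (x : ℂ)) x := by
        simpa using (hasDerivAt_pow 2 x).ofReal_comp
      exact (h1.const_mul (-b)).cexp)
    (by fun_prop)
    (fun x hx => by
      rw [Complex.norm_exp, Real.exp_le_one_iff]
      have : (-b * (x : ℂ) ^ 2).re = -(b.re * x ^ 2) := by
        rw [← Complex.ofReal_pow, Complex.re_mul_ofReal]; simp
      rw [this]; have := sq_nonneg x; nlinarith [mul_nonneg hb this])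
  have heq : ∫ y in B..R, ((y⁻¹ : ℝ) : ℂ) * (Complex.exp (-b * (y : ℂ) ^ 2) * (-b * (2 * (y : ℂ))))
      = (-2 * b) * ∫ y in B..R, Complex.exp (-b * (y : ℂ) ^ 2) := by
    rw [← intervalIntegral.integral_const_mul]
    refine intervalIntegral.integral_congr fun y hy => ?_
    rw [uIcc_of_le hBR] at hy
    have : (y : ℂ) ≠ 0 := by exact_mod_cast (hpos y hy).ne'
    simp only [Complex.ofReal_inv]
    field_simp
  rw [heq, norm_mul, norm_mul, norm_neg, Complex.norm_ofNat] at h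
  have hbn : 0 < ‖b‖ := norm_pos_iff.2 hb0
  rw [le_div_iff₀ (by positivity)]
  have : ‖b‖ * ‖∫ y in B..R, Complex.exp (-b * (y : ℂ) ^ 2)‖ ≤ B⁻¹ := by linarith
  calc _ = (‖b‖ * ‖∫ y in B..R, Complex.exp (-b * (y : ℂ) ^ 2)‖) * B := by ring
    _ ≤ B⁻¹ * B := by gcongr
    _ = 1 := inv_mul_cancel₀ hB.ne'

/-- A tail bound that is uniform up to the purely oscillatory case `r.re = 0`. -/
theorem norm_integral_rpow_mul_exp_tail_le {μ : ℝ} (hμ : μ < 1) {r : ℂ} (hr : 0 ≤ r.re)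
    (hr0 : r ≠ 0) {B R : ℝ} (hB : 0 < B) (hBR : B ≤ R) :
    ‖∫ z in B..R, ((z ^ (μ - 1) : ℝ) : ℂ) * Complex.exp (-r * z)‖ ≤ 2 * B ^ (μ - 1) / ‖r‖ := by
  have hpos : ∀ x ∈ Icc B R, 0 < x := fun x hx => hB.trans_le hx.1
  have h := norm_integral_antitone_mul_deriv_le (g := fun z => z ^ (μ - 1))
    (g' := fun z => (μ - 1) * z ^ (μ - 1 - 1))
    (v := fun z => Complex.exp (-r * (z : ℂ)))
    (v' := fun z => Complex.exp (-r * (z : ℂ)) * (-r)) hBR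
    (fun x hx => Real.hasDerivAt_rpow_const (.inl (hpos x hx).ne'))
    (fun x hx => (ContinuousAt.mul continuousAt_const
      (Real.continuousAt_rpow_const _ _ (.inl (hpos x hx).ne'))).continuousWithinAt)
    (fun x hx => mul_nonpos_of_nonpos_of_nonneg (by linarith)
      (Real.rpow_nonneg (hpos x hx).le _))
    (Real.rpow_nonneg (hpos R ⟨hBR, le_rfl⟩).le _)
    (fun x hx => by
      simpa using ((Complex.ofRealCLM.hasDerivAt (x := x)).const_mul (-r)).cexp)
    (by fun_prop)
    (fun x hx => by
      rw [Complex.norm_exp, Real.exp_le_one_iff]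
      have : (-r * (x : ℂ)).re = -(r.re * x) := by simp
      rw [this]; nlinarith [mul_nonneg hr (hpos x hx).le])
  have heq : ∫ z in B..R, ((z ^ (μ - 1) : ℝ) : ℂ) * (Complex.exp (-r * (z : ℂ)) * (-r))
      = (-r) * ∫ z in B..R, ((z ^ (μ - 1) : ℝ) : ℂ) * Complex.exp (-r * z) := by
    rw [← intervalIntegral.integral_const_mul]
    refine intervalIntegral.integral_congr fun y hy => ?_
    ring
  rw [heq, norm_mul, norm_neg] at h
  rw [le_div_iff₀ (norm_pos_iff.2 hr0)]
  linarith

/-- A bound on all tails `∫ y in B..R` bounds the error of truncating an integral over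
`(0, ∞)` at `B`. -/
theorem norm_integral_sub_integral_Ioi_le {f : ℝ → ℂ} {B K : ℝ} (hB : 0 ≤ B)
    (hf : IntegrableOn f (Ioi 0))
    (h : ∀ R, B ≤ R → ‖∫ y in B..R, f y‖ ≤ K) :
    ‖(∫ y in (0 : ℝ)..B, f y) - ∫ y in Ioi 0, f y‖ ≤ K := by
  have hi : ∀ a b : ℝ, 0 ≤ a → a ≤ b → IntervalIntegrable f volume a b := fun a b ha hab => by
    rw [intervalIntegrable_iff_integrableOn_Ioc_of_le hab]
    exact hf.mono_set fun x hx => ha.trans_lt hx.1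
  have hlim : Tendsto (fun R : ℝ => ‖(∫ y in (0 : ℝ)..B, f y) - ∫ y in (0 : ℝ)..R, f y‖) atTop
      (𝓝 ‖(∫ y in (0 : ℝ)..B, f y) - ∫ y in Ioi 0, f y‖) :=
    (tendsto_const_nhds.sub (intervalIntegral_tendsto_integral_Ioi 0 hf tendsto_id)).norm
  refine le_of_tendsto hlim ?_
  filter_upwards [eventually_ge_atTop B] with R hR
  rw [norm_sub_rev, intervalIntegral.integral_interval_sub_left (hi 0 R le_rfl (hB.trans hR))
    (hi 0 B le_rfl hB)]
  exact h R hR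

/-! ### Model integrals: truncated Fresnel and Gamma integrals -/

/-- A power of a positive multiple of a unit complex number `z = e^{iθ}`, for the principal argument
`θ`. -/
theorem ofReal_mul_cpow_ofReal {x α θ : ℝ} (hx : 0 < x) {z : ℂ}
    (hz : Complex.log z = θ * Complex.I) (hz0 : z ≠ 0) :
    ((x : ℂ) * z) ^ (α : ℂ) = ((x ^ α : ℝ) : ℂ) * Complex.exp (Complex.I * (θ * α)) := by
  have hx0 : (x : ℂ) ≠ 0 := by exact_mod_cast hx.ne'
  rw [Complex.cpow_def_of_ne_zero (mul_ne_zero hx0 hz0), Complex.log_ofReal_mul hx hz0, hz,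
    Real.rpow_def_of_pos hx, Complex.ofReal_exp, ← Complex.exp_add]
  push_cast
  ring_nf

theorem integrableOn_rpow_mul_exp_neg_mul {μ : ℝ} (hμ : 0 < μ) {a : ℝ} (ha : 0 < a) :
    IntegrableOn (fun z : ℝ => z ^ (μ - 1) * Real.exp (-a * z)) (Ioi 0) := by
  simpa using integrableOn_rpow_mul_exp_neg_mul_rpow (s := μ - 1) (p := 1) (by linarith) one_pos ha

/-- The Gamma integral with a complex rate `r`, by analytic continuation from real `r`: the left side
is the complex moment generating function of the measure `z ^ (μ - 1) dz` at `-r`. -/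
theorem integral_rpow_mul_exp_neg_complex_mul_Ioi {μ : ℝ} (hμ : 0 < μ) {r : ℂ} (hr : 0 < r.re) :
    ∫ z : ℝ in Ioi 0, ((z ^ (μ - 1) : ℝ) : ℂ) * Complex.exp (-r * z) =
      (1 / r) ^ (μ : ℂ) * Complex.Gamma μ := by
  let ν : Measure ℝ := (volume.restrict (Ioi 0)).withDensity fun z => ENNReal.ofReal (z ^ (μ - 1))
  have hmgf : ∀ w : ℂ, ProbabilityTheory.complexMGF id ν w =
      ∫ z : ℝ in Ioi 0, ((z ^ (μ - 1) : ℝ) : ℂ) * Complex.exp (w * z) := by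
    intro w
    simp only [ProbabilityTheory.complexMGF, id, ν]
    rw [integral_withDensity_eq_integral_toReal_smul (by fun_prop) (by simp)]
    refine setIntegral_congr_fun measurableSet_Ioi fun z hz => ?_
    simp [ENNReal.toReal_ofReal (Real.rpow_nonneg (le_of_lt hz) (μ - 1))]
  have hset : Iio 0 ⊆ interior (ProbabilityTheory.integrableExpSet id ν) := by
    refine interior_maximal (fun a ha => ?_) isOpen_Iio
    simp only [ProbabilityTheory.integrableExpSet, mem_ofPred_eq, id, ν]
    rw [integrable_withDensity_iff (by fun_prop) (by simp)]
    refine (integrableOn_rpow_mul_exp_neg_mul hμ (neg_pos.2 ha)).congr ?_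
    refine (ae_restrict_iff' measurableSet_Ioi).2 (.of_forall fun z hz => ?_)
    simp [ENNReal.toReal_ofReal (Real.rpow_nonneg (le_of_lt hz) (μ - 1)), mul_comm]
  have hopen : IsOpen {z : ℂ | 0 < z.re} := isOpen_lt continuous_const Complex.continuous_re
  -- both sides are analytic in `r` on the right half-plane and agree for real `r`
  have hf : AnalyticOnNhd ℂ (fun r => ProbabilityTheory.complexMGF id ν (-r)) {z | 0 < z.re} := by
    refine DifferentiableOn.analyticOnNhd (fun z hz => ?_) hopen
    have h1 := (ProbabilityTheory.hasDerivAt_complexMGF (X := id) (μ := ν) (z := -z)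
      (hset (by simpa using hz))).differentiableAt
    exact (h1.comp z differentiableAt_id.neg).differentiableWithinAt
  have hg : AnalyticOnNhd ℂ (fun r : ℂ => (1 / r) ^ (μ : ℂ) * Complex.Gamma μ) {z | 0 < z.re} := by
    refine DifferentiableOn.analyticOnNhd (fun z hz => ?_) hopen
    have hz0 : z ≠ 0 := fun h => by simp [h] at hz
    refine ((DifferentiableAt.cpow (differentiableAt_const _ |>.div differentiableAt_id hz0)
      (differentiableAt_const _) ?_).mul_const _).differentiableWithinAt
    left
    change 0 < (1 / z).re
    rw [one_div, Complex.inv_re]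
    exact div_pos hz (Complex.normSq_pos.2 hz0)
  have hreal : ∀ x : ℝ, 0 < x → ProbabilityTheory.complexMGF id ν (-(x : ℂ)) =
      (1 / (x : ℂ)) ^ (μ : ℂ) * Complex.Gamma μ := by
    intro x hx
    rw [hmgf, ← Complex.integral_cpow_mul_exp_neg_mul_Ioi (by simpa) hx]
    refine setIntegral_congr_fun measurableSet_Ioi fun z hz => ?_
    rw [Complex.ofReal_cpow (le_of_lt hz), neg_mul]
    push_cast
    rfl
  rw [← hmgf]
  refine hf.eqOn_of_preconnected_of_frequently_eq hg
    (convex_halfSpace_re_gt 0).isPreconnected (z₀ := 1) (by simp) ?_ hr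
  have ht : Tendsto (fun x : ℝ => (x : ℂ)) (𝓝[≠] 1) (𝓝[≠] 1) := by
    refine tendsto_nhdsWithin_iff.2 ⟨?_, ?_⟩
    · exact (Complex.continuous_ofReal.tendsto' 1 1 (by simp)).mono_left nhdsWithin_le_nhds
    · filter_upwards [self_mem_nhdsWithin] with x hx
      simpa using hx
  refine ht.frequently (Eventually.frequently ?_)
  filter_upwards [nhdsWithin_le_nhds (lt_mem_nhds one_pos)] with x hx using hreal x hx

/-- The truncated Fresnel integral, with an error that is uniform in `t`. The exact value is that of
the Gaussian integral with parameter `ε + it` in the limit `ε → 0⁺`. -/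
theorem norm_integral_fresnel_sub_le {t B : ℝ} (ht : 0 < t) (hB : 0 < B) :
    ‖(∫ y in (0 : ℝ)..B, Complex.exp (-(Complex.I * t) * (y : ℂ) ^ 2)) -
      ((Real.sqrt Real.pi : ℂ) / 2 * Complex.exp (-Complex.I * (Real.pi / 4)) *
        ((t ^ (-(1 / 2) : ℝ) : ℝ) : ℂ))‖ ≤ 1 / (t * B) := by
  have hdamped : ∀ ε : ℝ, 0 < ε →
      ‖(∫ y in (0 : ℝ)..B, Complex.exp (-(ε + Complex.I * t) * (y : ℂ) ^ 2)) -
        (Real.pi / (ε + Complex.I * t)) ^ (1 / 2 : ℂ) / 2‖ ≤ 1 / (t * B) := by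
    intro ε hε
    have hre : (ε + Complex.I * t : ℂ).re = ε := by simp
    have him : (ε + Complex.I * t : ℂ).im = t := by simp
    have hne : (ε + Complex.I * t : ℂ) ≠ 0 := fun h => by rw [h] at him; simp at him; linarith
    have hnorm : t ≤ ‖(ε + Complex.I * t : ℂ)‖ := by
      have := Complex.abs_im_le_norm (ε + Complex.I * t : ℂ)
      rw [him] at this
      exact (le_abs_self t).trans this
    rw [← integral_gaussian_complex_Ioi (by rwa [hre])]
    refine norm_integral_sub_integral_Ioi_le hB.le
      (integrable_cexp_neg_mul_sq (by rwa [hre])).integrableOn fun R hR => ?_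
    refine (norm_integral_gaussian_tail_le (by rw [hre]; exact hε.le) hne hB hR).trans ?_
    gcongr
  have hval : ((Real.pi : ℂ) / (Complex.I * t)) ^ (1 / 2 : ℂ) / 2 =
      (Real.sqrt Real.pi : ℂ) / 2 * Complex.exp (-Complex.I * (Real.pi / 4)) *
        ((t ^ (-(1 / 2) : ℝ) : ℝ) : ℂ) := by
    have h1 : (Real.pi : ℂ) / (Complex.I * t) = ((Real.pi / t : ℝ) : ℂ) * (-Complex.I) := by
      push_cast
      rw [div_mul_eq_div_div, div_right_comm, Complex.div_I, mul_neg]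
    have h2 := ofReal_mul_cpow_ofReal (x := Real.pi / t) (α := 1 / 2) (θ := -(Real.pi / 2))
      (by positivity) (z := -Complex.I) (by rw [Complex.log_neg_I]; push_cast; ring) (by simp)
    have h3 : (Real.pi / t) ^ (1 / 2 : ℝ) = Real.sqrt Real.pi * t ^ (-(1 / 2) : ℝ) := by
      rw [Real.div_rpow Real.pi_pos.le ht.le, Real.sqrt_eq_rpow, Real.rpow_neg ht.le]; rfl
    rw [h1, show (1 / 2 : ℂ) = ((1 / 2 : ℝ) : ℂ) by push_cast; rfl, h2, h3]
    push_cast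
    ring_nf
  rw [← hval]
  have hslit : (Real.pi : ℂ) / (Complex.I * t) ∈ Complex.slitPlane := by
    right
    rw [div_mul_eq_div_div, div_right_comm, Complex.div_I, ← Complex.ofReal_div]
    simp [ht.ne']
  have hlim : Tendsto (fun ε : ℝ =>
      ‖(∫ y in (0 : ℝ)..B, Complex.exp (-(ε + Complex.I * t) * (y : ℂ) ^ 2)) -
        (Real.pi / (ε + Complex.I * t)) ^ (1 / 2 : ℂ) / 2‖) (𝓝[>] 0)
      (𝓝 ‖(∫ y in (0 : ℝ)..B, Complex.exp (-(((0 : ℝ) : ℂ) + Complex.I * t) * (y : ℂ) ^ 2)) -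
        (Real.pi / (((0 : ℝ) : ℂ) + Complex.I * t)) ^ (1 / 2 : ℂ) / 2‖) := by
    refine Tendsto.mono_left ?_ nhdsWithin_le_nhds
    refine ContinuousAt.tendsto (f := fun ε : ℝ =>
      ‖(∫ y in (0 : ℝ)..B, Complex.exp (-(ε + Complex.I * t) * (y : ℂ) ^ 2)) -
        (Real.pi / (ε + Complex.I * t)) ^ (1 / 2 : ℂ) / 2‖) ?_
    refine (ContinuousAt.sub ?_ (ContinuousAt.div_const
      (ContinuousAt.cpow ?_ continuousAt_const ?_) _)).norm
    · exact (intervalIntegral.continuous_parametric_intervalIntegral_of_continuous'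
        (by fun_prop) 0 B).continuousAt
    · refine ContinuousAt.div continuousAt_const (by fun_prop) ?_
      simp [ht.ne']
    · simpa using hslit
  have := le_of_tendsto hlim (eventually_mem_nhdsWithin.mono fun ε hε => hdamped ε hε)
  simpa using this

/-- The truncated oscillatory Gamma integral, with an error that is uniform in `t`, from the damped
integral with rate `ε - it` in the limit `ε → 0⁺`. -/
theorem norm_integral_rpow_mul_exp_sub_le {t c μ : ℝ} (ht : 0 < t) (hc : 0 < c) (hμ : 0 < μ)
    (hμ1 : μ < 1) :
    ‖(∫ z in (0 : ℝ)..c, ((z ^ (μ - 1) : ℝ) : ℂ) * Complex.exp (Complex.I * t * z)) -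
      ((Real.Gamma μ : ℂ) * Complex.exp (Complex.I * (Real.pi * μ / 2)) *
        ((t ^ (-μ) : ℝ) : ℂ))‖ ≤ 2 * c ^ (μ - 1) / t := by
  have hdamped : ∀ ε : ℝ, 0 < ε →
      ‖(∫ z in (0 : ℝ)..c, ((z ^ (μ - 1) : ℝ) : ℂ) * Complex.exp (-(ε - Complex.I * t) * z)) -
        (1 / (ε - Complex.I * t)) ^ (μ : ℂ) * Complex.Gamma μ‖ ≤ 2 * c ^ (μ - 1) / t := by
    intro ε hε
    have hre : (ε - Complex.I * t : ℂ).re = ε := by simp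
    have him : (ε - Complex.I * t : ℂ).im = -t := by simp
    have hne : (ε - Complex.I * t : ℂ) ≠ 0 := fun h => by rw [h] at him; simp at him; linarith
    have hnorm : t ≤ ‖(ε - Complex.I * t : ℂ)‖ := by
      have := Complex.abs_im_le_norm (ε - Complex.I * t : ℂ)
      rw [him, abs_neg] at this
      exact (le_abs_self t).trans this
    have hint : IntegrableOn (fun z : ℝ =>
        ((z ^ (μ - 1) : ℝ) : ℂ) * Complex.exp (-(ε - Complex.I * t) * z)) (Ioi 0) := by
      refine (integrableOn_rpow_mul_exp_neg_mul hμ hε).mono'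
        (Measurable.aestronglyMeasurable (by fun_prop)) ?_
      refine (ae_restrict_iff' measurableSet_Ioi).2 (.of_forall fun z hz => ?_)
      rw [norm_mul, Complex.norm_real, Complex.norm_exp,
        Real.norm_of_nonneg (Real.rpow_nonneg (le_of_lt hz) _)]
      simp
    rw [← integral_rpow_mul_exp_neg_complex_mul_Ioi hμ (by rwa [hre])]
    refine norm_integral_sub_integral_Ioi_le hc.le hint fun R hR => ?_
    refine (norm_integral_rpow_mul_exp_tail_le hμ1 (by rw [hre]; exact hε.le) hne hc hR).trans ?_
    gcongr
  have hI : 1 / (((0 : ℝ) : ℂ) - Complex.I * t) = ((t⁻¹ : ℝ) : ℂ) * Complex.I := by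
    have : (t : ℂ) ≠ 0 := by exact_mod_cast ht.ne'
    push_cast
    rw [zero_sub, ← neg_mul, div_mul_eq_div_div, one_div, inv_neg, Complex.inv_I]
    field_simp
  have hval : (1 / (((0 : ℝ) : ℂ) - Complex.I * t)) ^ (μ : ℂ) * Complex.Gamma μ =
      (Real.Gamma μ : ℂ) * Complex.exp (Complex.I * (Real.pi * μ / 2)) *
        ((t ^ (-μ) : ℝ) : ℂ) := by
    rw [hI, ofReal_mul_cpow_ofReal (θ := Real.pi / 2) (inv_pos.2 ht)
      (by rw [Complex.log_I]; push_cast; rfl) Complex.I_ne_zero, Real.inv_rpow ht.le,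
      ← Real.rpow_neg ht.le, Complex.Gamma_ofReal]
    push_cast
    ring_nf
  rw [← hval]
  have hlim : Tendsto (fun ε : ℝ =>
      ‖(∫ z in (0 : ℝ)..c, ((z ^ (μ - 1) : ℝ) : ℂ) * Complex.exp (-(ε - Complex.I * t) * z)) -
        (1 / (ε - Complex.I * t)) ^ (μ : ℂ) * Complex.Gamma μ‖) (𝓝[>] 0)
      (𝓝 ‖(∫ z in (0 : ℝ)..c, ((z ^ (μ - 1) : ℝ) : ℂ) *
          Complex.exp (-(((0 : ℝ) : ℂ) - Complex.I * t) * z)) -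
        (1 / (((0 : ℝ) : ℂ) - Complex.I * t)) ^ (μ : ℂ) * Complex.Gamma μ‖) := by
    have hcint : Tendsto (fun ε : ℝ => ∫ z in (0 : ℝ)..c,
        ((z ^ (μ - 1) : ℝ) : ℂ) * Complex.exp (-(ε - Complex.I * t) * z)) (𝓝[>] 0)
        (𝓝 (∫ z in (0 : ℝ)..c, ((z ^ (μ - 1) : ℝ) : ℂ) *
          Complex.exp (-(((0 : ℝ) : ℂ) - Complex.I * t) * z))) := by
      refine intervalIntegral.tendsto_integral_filter_of_dominated_convergence
        (fun z => z ^ (μ - 1)) ?_ ?_ (intervalIntegral.intervalIntegrable_rpow' (by linarith)) ?_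
      · refine .of_forall fun ε => Measurable.aestronglyMeasurable (by fun_prop)
      · filter_upwards [self_mem_nhdsWithin] with ε hε
        refine .of_forall fun z hz => ?_
        rw [uIoc_of_le hc.le] at hz
        rw [norm_mul, Complex.norm_real, Real.norm_of_nonneg (Real.rpow_nonneg hz.1.le _)]
        refine mul_le_of_le_one_right (Real.rpow_nonneg hz.1.le _) ?_
        rw [Complex.norm_exp, Real.exp_le_one_iff]
        have := mul_nonneg (le_of_lt hε) hz.1.le
        simpa using this
      · refine .of_forall fun z hz => Tendsto.mono_left ?_ nhdsWithin_le_nhds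
        refine ContinuousAt.tendsto (f := fun ε : ℝ =>
          ((z ^ (μ - 1) : ℝ) : ℂ) * Complex.exp (-(ε - Complex.I * t) * z)) ?_
        fun_prop
    refine (hcint.sub (Tendsto.mul_const _ ?_)).norm
    refine Tendsto.mono_left ?_ nhdsWithin_le_nhds
    refine ContinuousAt.tendsto (f := fun ε : ℝ => (1 / (ε - Complex.I * t)) ^ (μ : ℂ)) ?_
    refine ContinuousAt.cpow ?_ continuousAt_const ?_
    · refine ContinuousAt.div continuousAt_const (by fun_prop) ?_
      simp [ht.ne']
    · rw [hI]
      right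
      simp [ht.ne']
  have := le_of_tendsto hlim (eventually_mem_nhdsWithin.mono fun ε hε => hdamped ε hε)
  simpa using this

/-! ### Remainder at the stationary point -/

theorem hasDerivAt_cexp_quadratic (t y : ℝ) :
    HasDerivAt (fun y : ℝ => Complex.exp (-(Complex.I * t) * (y : ℂ) ^ 2))
      (Complex.exp (-(Complex.I * t) * (y : ℂ) ^ 2) * (-(Complex.I * t) * (2 * y))) y := by
  have h1 : HasDerivAt (fun y : ℝ => (y : ℂ) ^ 2) (2 * (y : ℂ)) y := by
    simpa using (hasDerivAt_pow 2 y).ofReal_comp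
  exact (h1.const_mul _).cexp

theorem norm_cexp_quadratic (t y : ℝ) : ‖Complex.exp (-(Complex.I * t) * (y : ℂ) ^ 2)‖ = 1 := by
  rw [Complex.norm_exp, ← Complex.ofReal_pow, Complex.re_mul_ofReal]; simp

/-- An amplitude which vanishes at the stationary point, with bounded derivative, contributes
`O(log t / t)`, hence `O(t⁻¹ + t ^ (-δ))` for every `δ < 1`. The integral is cut at distance
`t ^ (-1/2)` from the stationary point. -/
theorem norm_integral_mul_cexp_quadratic_le {h h' : ℝ → ℂ} {B M δ t : ℝ} (hB : 0 < B) (hM : 0 ≤ M)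
    (hδ : δ < 1) (ht : 0 < t) (hc : ContinuousOn h (Icc 0 B))
    (hd : ∀ y ∈ Ioo 0 B, HasDerivAt h (h' y) y) (hdc : ContinuousOn h' (Ioo 0 B))
    (hle : ∀ y ∈ Icc 0 B, ‖h y‖ ≤ M * y) (hdle : ∀ y ∈ Ioo 0 B, ‖h' y‖ ≤ M) :
    ‖∫ y in (0 : ℝ)..B, h y * Complex.exp (-(Complex.I * t) * (y : ℂ) ^ 2)‖ ≤
      M * (2 + B ^ (2 * (1 - δ)) / (2 * (1 - δ))) * (t ^ (-1 : ℝ) + t ^ (-δ)) := by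
  have hη : 0 < 2 * (1 - δ) := by linarith
  have htδ : 0 ≤ t ^ (-δ) := Real.rpow_nonneg ht.le _
  have ht1 : t ^ (-1 : ℝ) = t⁻¹ := Real.rpow_neg_one t
  have hQ : 0 ≤ B ^ (2 * (1 - δ)) / (2 * (1 - δ)) := by positivity
  have htinv : 0 < t⁻¹ := inv_pos.2 ht
  -- the part of the integral next to the stationary point is estimated by its length
  have hnear : ∀ r, 0 < r → r ≤ B →
      ‖∫ y in (0 : ℝ)..r, h y * Complex.exp (-(Complex.I * t) * (y : ℂ) ^ 2)‖ ≤ M * r ^ 2 := by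
    intro r hr hrB
    have := intervalIntegral.norm_integral_le_of_norm_le_const (a := 0) (b := r) (C := M * r)
      (f := fun y : ℝ => h y * Complex.exp (-(Complex.I * t) * (y : ℂ) ^ 2)) fun y hy => by
        rw [uIoc_of_le hr.le] at hy
        rw [norm_mul, norm_cexp_quadratic, mul_one]
        refine (hle y ⟨hy.1.le, hy.2.trans hrB⟩).trans ?_
        exact mul_le_mul_of_nonneg_left hy.2 hM
    rw [sub_zero, abs_of_pos hr] at this
    linarith [sq r, mul_assoc M r r]
  rw [ht1]
  set r := (Real.sqrt t)⁻¹ with hrdef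
  have hr : 0 < r := inv_pos.2 (Real.sqrt_pos.2 ht)
  have hr2 : r ^ 2 = t⁻¹ := by rw [hrdef, inv_pow, Real.sq_sqrt ht.le]
  rcases le_total B r with hBr | hrB
  · refine (hnear B hB le_rfl).trans ?_
    have : B ^ 2 ≤ t⁻¹ := by rw [← hr2]; gcongr
    calc M * B ^ 2 ≤ M * t⁻¹ := by gcongr
      _ ≤ M * (2 + B ^ (2 * (1 - δ)) / (2 * (1 - δ))) * (t⁻¹ + t ^ (-δ)) := by
        rw [mul_assoc]
        gcongr
        nlinarith [mul_nonneg hQ htinv.le, mul_nonneg hQ htδ]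
  · have hpos : ∀ y ∈ Icc r B, 0 < y := fun y hy => hr.trans_le hy.1
    have hI : Icc r B ⊆ Icc 0 B := Icc_subset_Icc_left hr.le
    have hO : Ioo r B ⊆ Ioo 0 B := Ioo_subset_Ioo_left hr.le
    have hci : ∀ a b, 0 ≤ a → a ≤ b → b ≤ B → IntervalIntegrable (fun y =>
        h y * Complex.exp (-(Complex.I * t) * (y : ℂ) ^ 2)) volume a b := fun a b ha hab hb => by
      refine ContinuousOn.intervalIntegrable ?_
      rw [uIcc_of_le hab]
      exact (hc.mono (Icc_subset_Icc ha hb)).mul (by fun_prop)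
    have hsplit := intervalIntegral.integral_add_adjacent_intervals (hci 0 r le_rfl hr.le hrB)
      (hci r B hr.le hrB le_rfl)
    have hcont_inv : ContinuousOn (fun y : ℝ => (y : ℂ)⁻¹) (Icc r B) :=
      ContinuousOn.inv₀ (by fun_prop) fun y hy => by exact_mod_cast (hpos y hy).ne'
    -- away from the stationary point, `h y / y` is integrated by parts against the derivative of the
    -- exponential; the majorant `2 * M / y` of its derivative is the source of the logarithm
    have hbp := norm_integral_mul_deriv_le (u := fun y => h y * (y : ℂ)⁻¹)
      (u' := fun y => h' y * (y : ℂ)⁻¹ + h y * (-((1 : ℝ) : ℂ) / (y : ℂ) ^ 2))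
      (v := fun y => Complex.exp (-(Complex.I * t) * (y : ℂ) ^ 2))
      (B := fun y => 2 * M * y⁻¹) hrB
      ((hc.mono hI).mul hcont_inv) (by fun_prop)
      (fun y hy => by
        have hy0 : (y : ℂ) ≠ 0 := by exact_mod_cast (hpos y (Ioo_subset_Icc_self hy)).ne'
        refine (hd y (hO hy)).mul ?_
        exact HasDerivAt.inv (HasDerivAt.ofReal_comp (hasDerivAt_id y)) hy0)
      (fun y _ => hasDerivAt_cexp_quadratic t y)
      (((hdc.mono hO).mul (hcont_inv.mono Ioo_subset_Icc_self)).add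
        ((hc.mono (Ioo_subset_Icc_self.trans hI)).mul (continuousOn_const.div (by fun_prop)
          fun y hy => pow_ne_zero 2 (by exact_mod_cast (hpos y (Ioo_subset_Icc_self hy)).ne'))))
      (Continuous.intervalIntegrable (by fun_prop) _ _)
      ((intervalIntegral.intervalIntegrable_inv (fun y hy => by
        rw [uIcc_of_le hrB] at hy; exact (hpos y hy).ne') continuousOn_id).const_mul _)
      (fun y hy => by
        have hy0 := hpos y (Ioo_subset_Icc_self hy)
        have h1 := hdle y (hO hy)
        have h2 := hle y (hI (Ioo_subset_Icc_self hy))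
        refine (norm_add_le _ _).trans ?_
        rw [norm_mul, norm_mul, norm_div, norm_neg, Complex.ofReal_one, norm_one,
          norm_pow, norm_inv, Complex.norm_real, Real.norm_of_nonneg hy0.le]
        calc ‖h' y‖ * y⁻¹ + ‖h y‖ * (1 / y ^ 2) ≤ M * y⁻¹ + M * y * (1 / y ^ 2) := by gcongr
          _ = 2 * M * y⁻¹ := by field_simp; ring)
      (fun y _ => (norm_cexp_quadratic t y).le)
    have heq : ∫ y in r..B, h y * (y : ℂ)⁻¹ * (Complex.exp (-(Complex.I * t) * (y : ℂ) ^ 2) *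
        (-(Complex.I * t) * (2 * y))) = (-(Complex.I * t) * 2) *
        ∫ y in r..B, h y * Complex.exp (-(Complex.I * t) * (y : ℂ) ^ 2) := by
      rw [← intervalIntegral.integral_const_mul]
      refine intervalIntegral.integral_congr fun y hy => ?_
      rw [uIcc_of_le hrB] at hy
      have hy0 : (y : ℂ) ≠ 0 := by exact_mod_cast (hpos y hy).ne'
      field_simp
    have hend : ∀ y ∈ Icc r B, ‖h y * (y : ℂ)⁻¹‖ ≤ M := fun y hy => by
      rw [norm_mul, norm_inv, Complex.norm_real, Real.norm_of_nonneg (hpos y hy).le,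
        ← div_eq_mul_inv, div_le_iff₀ (hpos y hy)]
      exact hle y (hI hy)
    rw [heq, intervalIntegral.integral_const_mul, integral_inv_of_pos hr hB, norm_mul, norm_mul,
      norm_neg, norm_mul, Complex.norm_I, Complex.norm_real, Real.norm_of_nonneg ht.le,
      Complex.norm_ofNat] at hbp
    -- the exponent is chosen so that `(B / r) ^ (2 * (1 - δ))` with `r = t ^ (-1/2)` is a multiple of
    -- `t ^ (1 - δ)`
    have hlog : Real.log (B / r) ≤ B ^ (2 * (1 - δ)) / (2 * (1 - δ)) * (t * t ^ (-δ)) := by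
      refine (Real.log_le_rpow_div (by positivity) hη).trans_eq ?_
      rw [hrdef, div_inv_eq_mul, Real.mul_rpow hB.le (Real.sqrt_nonneg t), Real.sqrt_eq_rpow,
        ← Real.rpow_mul ht.le, show (1 / 2 * (2 * (1 - δ)) : ℝ) = 1 + -δ by ring,
        Real.rpow_add ht, Real.rpow_one]
      ring
    have h1 := hend r ⟨le_rfl, hrB⟩
    have h2 := hend B ⟨hrB, le_rfl⟩
    have hn := hnear r hr hrB
    rw [hr2] at hn
    have hfar : ‖∫ y in r..B, h y * Complex.exp (-(Complex.I * t) * (y : ℂ) ^ 2)‖ ≤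
        M * t⁻¹ + M * (B ^ (2 * (1 - δ)) / (2 * (1 - δ)) * t ^ (-δ)) := by
      have h3 : t * ‖∫ y in r..B, h y * Complex.exp (-(Complex.I * t) * (y : ℂ) ^ 2)‖ ≤
          M + M * (B ^ (2 * (1 - δ)) / (2 * (1 - δ)) * (t * t ^ (-δ))) := by
        nlinarith [mul_le_mul_of_nonneg_left hlog hM]
      calc _ = t⁻¹ * (t * ‖∫ y in r..B, h y * Complex.exp (-(Complex.I * t) * (y : ℂ) ^ 2)‖) := by
            field_simp
        _ ≤ t⁻¹ * (M + M * (B ^ (2 * (1 - δ)) / (2 * (1 - δ)) * (t * t ^ (-δ)))) := by gcongr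
        _ = _ := by field_simp
    rw [← hsplit]
    refine (norm_add_le _ _).trans ((add_le_add hn hfar).trans ?_)
    have h4 := mul_nonneg hM (mul_nonneg hQ htinv.le)
    have h5 := mul_nonneg hM htδ
    nlinarith

/-! ### Contribution of the singular endpoint -/

/-- The substitution `z = s (2a - s)` turns the quadratic phase at the endpoint into a linear one. -/
theorem integral_comp_quadratic_rpow_mul_exp {a c μ t : ℝ} (hc : 0 < c) (hca : 2 * c ≤ a)
    (hμ : 0 < μ) (hμ1 : μ < 1) :
    ∫ s in (0 : ℝ)..c, (((s * (2 * a - s)) ^ (μ - 1) : ℝ) : ℂ) *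
        Complex.exp (Complex.I * t * ((s * (2 * a - s) : ℝ) : ℂ)) * (2 * (a - s) : ℂ) =
      ∫ z in (0 : ℝ)..(c * (2 * a - c)), ((z ^ (μ - 1) : ℝ) : ℂ) *
        Complex.exp (Complex.I * t * z) := by
  have hcont : ContinuousOn (fun z : ℝ => ((z ^ (μ - 1) : ℝ) : ℂ) * Complex.exp (Complex.I * t * z))
      (Ioi 0) := by
    refine ContinuousOn.mul (Complex.continuous_ofReal.comp_continuousOn ?_) (by fun_prop)
    exact fun z hz => (Real.continuousAt_rpow_const z _ (.inl (ne_of_gt hz))).continuousWithinAt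
  have hnorm : ∀ z : ℝ, 0 ≤ z → ‖((z ^ (μ - 1) : ℝ) : ℂ) * Complex.exp (Complex.I * t * z)‖ =
      z ^ (μ - 1) := fun z hz => by
    rw [norm_mul, Complex.norm_real, Real.norm_of_nonneg (Real.rpow_nonneg hz _), Complex.norm_exp]
    simp
  have hd : ∀ s : ℝ, HasDerivAt (fun s => s * (2 * a - s)) (2 * (a - s)) s := fun s => by
    refine ((hasDerivAt_id s).mul ((hasDerivAt_id s).const_sub (2 * a))).congr_deriv ?_
    simp only [id]; ring
  have himg : (fun s => s * (2 * a - s)) '' Icc 0 c ⊆ Icc 0 (c * (2 * a - c)) := by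
    rintro _ ⟨s, hs, rfl⟩
    exact ⟨mul_nonneg hs.1 (by linarith [hs.2]), by simp only; nlinarith [hs.1, hs.2]⟩
  have h := intervalIntegral.integral_deriv_smul_comp''' (a := 0) (b := c)
    (f := fun s => s * (2 * a - s)) (f' := fun s => 2 * (a - s))
    (g := fun z : ℝ => ((z ^ (μ - 1) : ℝ) : ℂ) * Complex.exp (Complex.I * t * z))
    (by fun_prop) (fun s _ => (hd s).hasDerivWithinAt)
    (hcont.mono (by
      rw [min_eq_left hc.le, max_eq_right hc.le]
      rintro _ ⟨s, hs, rfl⟩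
      exact mul_pos hs.1 (by linarith [hs.2])))
    (by
      rw [uIcc_of_le hc.le]
      refine IntegrableOn.mono_set ?_ himg
      rw [integrableOn_Icc_iff_integrableOn_Ioc]
      have := intervalIntegral.intervalIntegrable_rpow' (a := 0) (b := c * (2 * a - c))
        (r := μ - 1) (by linarith)
      rw [intervalIntegrable_iff_integrableOn_Ioc_of_le
        (mul_nonneg hc.le (by linarith))] at this
      refine this.mono' (Measurable.aestronglyMeasurable (by fun_prop))
        ((ae_restrict_iff' measurableSet_Ioc).2 (.of_forall fun z hz => (hnorm z hz.1.le).le)))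
    (by
      rw [uIcc_of_le hc.le, integrableOn_Icc_iff_integrableOn_Ioc]
      have := (intervalIntegral.intervalIntegrable_rpow' (a := 0) (b := c)
        (r := μ - 1) (by linarith)).const_mul (2 * a * c ^ (μ - 1))
      rw [intervalIntegrable_iff_integrableOn_Ioc_of_le hc.le] at this
      refine this.mono' (Measurable.aestronglyMeasurable (by fun_prop))
        ((ae_restrict_iff' measurableSet_Ioc).2 (.of_forall fun s hs => ?_))
      rw [norm_smul, Function.comp_apply, hnorm _ (mul_nonneg hs.1.le (by linarith [hs.2])),
        Real.norm_of_nonneg (by linarith [hs.2]),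
        Real.mul_rpow hs.1.le (by linarith [hs.2])]
      have h1 : (2 * a - s) ^ (μ - 1) ≤ c ^ (μ - 1) :=
        Real.rpow_le_rpow_of_nonpos hc (by linarith [hs.2]) (by linarith)
      have h2 : 0 ≤ s ^ (μ - 1) := Real.rpow_nonneg hs.1.le _
      calc 2 * (a - s) * (s ^ (μ - 1) * (2 * a - s) ^ (μ - 1))
          ≤ (2 * a) * (s ^ (μ - 1) * c ^ (μ - 1)) := by
            have := hs.1
            have := hs.2
            refine mul_le_mul (by linarith) (by gcongr) ?_ (by linarith)
            exact mul_nonneg h2 (Real.rpow_nonneg (by linarith) _)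
        _ = _ := by ring)
  rw [zero_mul] at h
  rw [← h]
  refine intervalIntegral.integral_congr fun s _ => ?_
  simp only [Function.comp, Complex.real_smul]
  push_cast
  ring

/-- The contribution of the singular endpoint `s = 0`, for the phase `s (2a - s)` which has no stationary
point on `[0, c]`. The amplitude `s ^ (μ - 1) w(s)` is compared with a multiple of
`(s (2a - s)) ^ (μ - 1)` times the derivative of the phase, for which the integral is explicit; the
difference is `s ^ (μ - 1) k(s)` times the derivative of the phase, with `k 0 = 0`, and integration
by parts makes it `O(t⁻¹)`. -/
theorem norm_integral_endpoint_sub_le {w w' : ℝ → ℂ} {a c μ t M : ℝ} (hc : 0 < c) (hca : 2 * c ≤ a)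
    (hμ : 0 < μ) (hμ1 : μ < 1) (ht : 0 < t)
    (hw : ∀ s ∈ Icc 0 c, HasDerivWithinAt w (w' s) (Icc 0 c) s) (hw'c : ContinuousOn w' (Icc 0 c))
    (hwM : ∀ s ∈ Icc 0 c, ‖w s‖ ≤ M) (hw'M : ∀ s ∈ Icc 0 c, ‖w' s‖ ≤ M) :
    ‖(∫ s in (0 : ℝ)..c, ((s ^ (μ - 1) : ℝ) : ℂ) * w s *
        Complex.exp (Complex.I * t * ((s * (2 * a - s) : ℝ) : ℂ))) -
      w 0 * (((2 * a) ^ (-μ) : ℝ) : ℂ) * ((Real.Gamma μ : ℂ) *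
        Complex.exp (Complex.I * (Real.pi * μ / 2)) * ((t ^ (-μ) : ℝ) : ℂ))‖ ≤
      ((M / c + 2 * M / c ^ 2) * (c ^ μ + 2 * (c ^ μ / μ)) +
        M * c ^ (-μ) * (2 * (c ^ 2) ^ (μ - 1))) / t := by
  have h0mem : (0 : ℝ) ∈ Icc 0 c := ⟨le_rfl, hc.le⟩
  have hM : 0 ≤ M := (norm_nonneg _).trans (hwM 0 h0mem)
  set D := M / c + 2 * M / c ^ 2 with hDdef
  have hD : 0 ≤ D := by positivity
  -- `A` is the multiple of `(s (2a - s)) ^ (μ - 1)` that matches the amplitude at `s = 0`, and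
  -- `s ^ (μ - 1) * k s` is the remaining amplitude divided by the derivative of the phase
  let A : ℂ := w 0 * (((2 * a) ^ (-μ) : ℝ) : ℂ)
  have hA : ‖A‖ ≤ M * c ^ (-μ) := by
    rw [norm_mul, Complex.norm_real, Real.norm_of_nonneg (Real.rpow_nonneg (by linarith) _)]
    have := Real.rpow_le_rpow_of_nonpos hc (by linarith : c ≤ 2 * a) (by linarith : -μ ≤ 0)
    exact mul_le_mul (hwM 0 h0mem) this (Real.rpow_nonneg (by linarith) _) hM
  let k : ℝ → ℂ := fun s => w s * ((2 * (a - s))⁻¹ : ℝ) - A * (((2 * a - s) ^ (μ - 1) : ℝ) : ℂ)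
  let k' : ℝ → ℂ := fun s =>
    w' s * ((2 * (a - s))⁻¹ : ℝ) + w s * ((2 / (2 * (a - s)) ^ 2 : ℝ) : ℂ) -
    A * (((1 - μ) * (2 * a - s) ^ (μ - 2) : ℝ) : ℂ)
  -- on `[0, c]` the factors `a - s` and `2a - s` are at least `c`, as `2c ≤ a`
  have hkd : ∀ s ∈ Icc 0 c, HasDerivWithinAt k (k' s) (Icc 0 c) s := by
    intro s hs
    have h1 : HasDerivAt (fun s => (2 * (a - s))⁻¹) (2 / (2 * (a - s)) ^ 2) s := by
      refine ((((hasDerivAt_id s).const_sub a).const_mul 2).inv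
        (by simp only [id]; linarith [hs.2])).congr_deriv ?_
      simp only [id]; ring
    have h2 : HasDerivAt (fun s => (2 * a - s) ^ (μ - 1)) ((1 - μ) * (2 * a - s) ^ (μ - 2)) s := by
      refine ((((hasDerivAt_id s).const_sub (2 * a))).rpow_const (p := μ - 1)
        (.inl (by simp only [id]; linarith [hs.2]))).congr_deriv ?_
      simp only [id]; ring_nf
    exact ((hw s hs).mul h1.ofReal_comp.hasDerivWithinAt).sub
      (h2.ofReal_comp.hasDerivWithinAt.const_mul A)
  have hkc : ContinuousOn k (Icc 0 c) := fun s hs => (hkd s hs).continuousWithinAt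
  have hk'c : ContinuousOn k' (Icc 0 c) := by
    have hwc : ContinuousOn w (Icc 0 c) := fun s hs => (hw s hs).continuousWithinAt
    refine ((hw'c.mul ?_).add (hwc.mul ?_)).sub (continuousOn_const.mul ?_)
    all_goals refine Complex.continuous_ofReal.comp_continuousOn ?_
    · exact ContinuousOn.inv₀ (by fun_prop) fun s hs => by linarith [hs.2]
    · exact ContinuousOn.div (by fun_prop) (by fun_prop) fun s hs =>
        pow_ne_zero 2 (by linarith [hs.2])
    · exact continuousOn_const.mul (ContinuousOn.rpow_const (by fun_prop)
        fun s hs => .inl (by linarith [hs.2]))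
  have hk'D : ∀ s ∈ Icc 0 c, ‖k' s‖ ≤ D := by
    intro s hs
    have has : c ≤ a - s := by linarith [hs.2]
    have has0 : 0 < a - s := hc.trans_le has
    have h1 : ‖(((2 * (a - s))⁻¹ : ℝ) : ℂ)‖ ≤ c⁻¹ := by
      rw [Complex.norm_real, Real.norm_of_nonneg (by positivity)]
      exact inv_anti₀ hc (by linarith)
    have h2 : ‖((2 / (2 * (a - s)) ^ 2 : ℝ) : ℂ)‖ ≤ 1 / c ^ 2 := by
      rw [Complex.norm_real, Real.norm_of_nonneg (by positivity),
        div_le_div_iff₀ (by positivity) (by positivity)]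
      nlinarith
    have h3 : ‖(((1 - μ) * (2 * a - s) ^ (μ - 2) : ℝ) : ℂ)‖ ≤ c ^ (μ - 2) := by
      have h4 := Real.rpow_nonneg (by linarith : 0 ≤ 2 * a - s) (μ - 2)
      rw [Complex.norm_real, Real.norm_of_nonneg (mul_nonneg (by linarith) h4)]
      have := Real.rpow_le_rpow_of_nonpos hc (by linarith : c ≤ 2 * a - s) (by linarith : μ - 2 ≤ 0)
      nlinarith
    have h5 : c ^ (-μ) * c ^ (μ - 2) = 1 / c ^ 2 := by
      rw [← Real.rpow_add hc, show -μ + (μ - 2) = -(2 : ℕ) by push_cast; ring,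
        Real.rpow_neg hc.le, Real.rpow_natCast, one_div]
    calc ‖k' s‖ ≤ ‖w' s‖ * ‖(((2 * (a - s))⁻¹ : ℝ) : ℂ)‖ +
          ‖w s‖ * ‖((2 / (2 * (a - s)) ^ 2 : ℝ) : ℂ)‖ +
          ‖A‖ * ‖(((1 - μ) * (2 * a - s) ^ (μ - 2) : ℝ) : ℂ)‖ := by
          rw [← norm_mul, ← norm_mul, ← norm_mul]
          exact (norm_sub_le _ _).trans (add_le_add_left (norm_add_le _ _) _)
      _ ≤ M * c⁻¹ + M * (1 / c ^ 2) + (M * c ^ (-μ)) * c ^ (μ - 2) := by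
          have := hwM s hs
          have := hw'M s hs
          gcongr
      _ = D := by rw [mul_assoc M, h5, hDdef]; ring
  have hk0 : k 0 = 0 := by
    have h2a : 0 < 2 * a := by linarith
    have : (2 * a) ^ (-μ) * (2 * a) ^ (μ - 1) = (2 * a)⁻¹ := by
      rw [← Real.rpow_add h2a, show -μ + (μ - 1) = -1 by ring, Real.rpow_neg_one]
    simp only [k, A, sub_zero]
    rw [mul_assoc, ← Complex.ofReal_mul, this, sub_self]
  have hkD : ∀ s ∈ Icc 0 c, ‖k s‖ ≤ D * s := by
    intro s hs
    have := Convex.norm_image_sub_le_of_norm_hasDerivWithin_le hkd hk'D (convex_Icc 0 c) h0mem hs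
    rwa [hk0, sub_zero, sub_zero, Real.norm_of_nonneg hs.1] at this
  have huD : ∀ s ∈ Icc 0 c, ‖((s ^ (μ - 1) : ℝ) : ℂ) * k s‖ ≤ D * s ^ μ := by
    intro s hs
    rcases eq_or_lt_of_le hs.1 with h | h
    · rw [← h, hk0, mul_zero, norm_zero]; positivity
    · rw [norm_mul, Complex.norm_real, Real.norm_of_nonneg (Real.rpow_nonneg h.le _)]
      calc s ^ (μ - 1) * ‖k s‖ ≤ s ^ (μ - 1) * (D * s) := by gcongr; exact hkD s hs
        _ = D * s ^ μ := by rw [Real.rpow_sub_one h.ne']; field_simp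
  have huc : ContinuousOn (fun s : ℝ => ((s ^ (μ - 1) : ℝ) : ℂ) * k s) (Icc 0 c) := by
    intro s hs
    rcases eq_or_lt_of_le hs.1 with h | h
    -- at `0` the factor `s ^ (μ - 1)` is unbounded, but the product is `O(s ^ μ)`
    · subst h
      rw [ContinuousWithinAt, hk0, mul_zero]
      refine squeeze_zero_norm' (a := fun s => D * s ^ μ)
        (eventually_mem_nhdsWithin.mono fun s hs => huD s hs) ?_
      have : Continuous fun s : ℝ => D * s ^ μ :=
        continuous_const.mul (Real.continuous_rpow_const hμ.le)
      exact (this.tendsto' 0 0 (by simp [Real.zero_rpow hμ.ne'])).mono_left nhdsWithin_le_nhds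
    · exact ((Complex.continuous_ofReal.continuousAt.comp
        (Real.continuousAt_rpow_const s _ (.inl h.ne'))).continuousWithinAt).mul (hkc s hs)
  have hvn : ∀ s : ℝ, ‖Complex.exp (Complex.I * t * ((s * (2 * a - s) : ℝ) : ℂ))‖ = 1 := fun s => by
    rw [Complex.norm_exp]; simp
  have hbp := norm_integral_mul_deriv_le (u := fun s : ℝ => ((s ^ (μ - 1) : ℝ) : ℂ) * k s)
    (u' := fun s => (((μ - 1) * s ^ (μ - 1 - 1) : ℝ) : ℂ) * k s + ((s ^ (μ - 1) : ℝ) : ℂ) * k' s)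
    (v := fun s : ℝ => Complex.exp (Complex.I * t * ((s * (2 * a - s) : ℝ) : ℂ)))
    (v' := fun s : ℝ => Complex.exp (Complex.I * t * ((s * (2 * a - s) : ℝ) : ℂ)) *
      (Complex.I * t * ((2 * (a - s) : ℝ) : ℂ)))
    (B := fun s => 2 * D * s ^ (μ - 1)) hc.le huc (by fun_prop)
    (fun s hs => (Real.hasDerivAt_rpow_const (.inl hs.1.ne')).ofReal_comp.mul
      ((hkd s (Ioo_subset_Icc_self hs)).hasDerivAt (Icc_mem_nhds hs.1 hs.2)))
    (fun s hs => by
      have hd : HasDerivAt (fun s => s * (2 * a - s)) (2 * (a - s)) s := by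
        refine ((hasDerivAt_id s).mul ((hasDerivAt_id s).const_sub (2 * a))).congr_deriv ?_
        simp only [id]; ring
      exact (hd.ofReal_comp.const_mul _).cexp)
    (by
      have hr : ∀ p : ℝ, ContinuousOn (fun s : ℝ => s ^ p) (Ioo 0 c) := fun p s hs =>
        (Real.continuousAt_rpow_const s p (.inl hs.1.ne')).continuousWithinAt
      exact ((Complex.continuous_ofReal.comp_continuousOn (continuousOn_const.mul (hr _))).mul
        (hkc.mono Ioo_subset_Icc_self)).add ((Complex.continuous_ofReal.comp_continuousOn
        (hr _)).mul (hk'c.mono Ioo_subset_Icc_self)))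
    (Continuous.intervalIntegrable (by fun_prop) _ _)
    ((intervalIntegral.intervalIntegrable_rpow' (by linarith)).const_mul _)
    (fun s hs => by
      have h1 := hkD s (Ioo_subset_Icc_self hs)
      have h2 := hk'D s (Ioo_subset_Icc_self hs)
      have h3 : 0 < s ^ (μ - 1) := Real.rpow_pos_of_pos hs.1 _
      have h4 : 0 < s ^ (μ - 1 - 1) := Real.rpow_pos_of_pos hs.1 _
      refine (norm_add_le _ _).trans ?_
      rw [norm_mul, norm_mul, Complex.norm_real, Complex.norm_real, norm_mul,
        Real.norm_of_nonneg h3.le, Real.norm_of_nonneg h4.le, Real.norm_of_nonpos (by linarith)]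
      have h5 : s ^ (μ - 1 - 1) * s = s ^ (μ - 1) := by
        rw [Real.rpow_sub_one hs.1.ne' (μ - 1)]; field_simp [hs.1.ne']
      calc -(μ - 1) * s ^ (μ - 1 - 1) * ‖k s‖ + s ^ (μ - 1) * ‖k' s‖
          ≤ 1 * s ^ (μ - 1 - 1) * (D * s) + s ^ (μ - 1) * D := by
            gcongr
            linarith
        _ = D * (s ^ (μ - 1 - 1) * s) + s ^ (μ - 1) * D := by ring
        _ = 2 * D * s ^ (μ - 1) := by rw [h5]; ring)
    (fun s _ => (hvn s).le)
  have hexp : Continuous fun s : ℝ => Complex.exp (Complex.I * t * ((s * (2 * a - s) : ℝ) : ℂ)) := by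
    fun_prop
  have hrpow : IntervalIntegrable (fun s : ℝ => ((s ^ (μ - 1) : ℝ) : ℂ)) volume 0 c :=
    have h := intervalIntegral.intervalIntegrable_rpow' (a := 0) (b := c) (r := μ - 1) (by linarith)
    ⟨h.1.ofReal, h.2.ofReal⟩
  have hX : IntervalIntegrable (fun s : ℝ => ((s ^ (μ - 1) : ℝ) : ℂ) * w s *
      Complex.exp (Complex.I * t * ((s * (2 * a - s) : ℝ) : ℂ))) volume 0 c := by
    refine (hrpow.mul_continuousOn ?_).mul_continuousOn hexp.continuousOn
    rw [uIcc_of_le hc.le]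
    exact fun s hs => (hw s hs).continuousWithinAt
  have hmul : ∀ s ∈ Icc 0 c, (s * (2 * a - s)) ^ (μ - 1) = s ^ (μ - 1) * (2 * a - s) ^ (μ - 1) :=
    fun s hs => Real.mul_rpow hs.1 (by linarith [hs.2])
  have hY : IntervalIntegrable (fun s : ℝ => (((s * (2 * a - s)) ^ (μ - 1) : ℝ) : ℂ) *
      Complex.exp (Complex.I * t * ((s * (2 * a - s) : ℝ) : ℂ)) * (2 * (a - s) : ℂ)) volume 0 c := by
    have h1 : IntervalIntegrable (fun s : ℝ => ((s ^ (μ - 1) : ℝ) : ℂ) *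
        ((((2 * a - s) ^ (μ - 1) : ℝ) : ℂ) * Complex.exp (Complex.I * t *
          ((s * (2 * a - s) : ℝ) : ℂ)) * (2 * (a - s) : ℂ))) volume 0 c := by
      refine hrpow.mul_continuousOn ?_
      rw [uIcc_of_le hc.le]
      refine ((Complex.continuous_ofReal.comp_continuousOn ?_).mul hexp.continuousOn).mul
        (by fun_prop)
      exact ContinuousOn.rpow_const (by fun_prop) fun s hs => .inl (by linarith [hs.2])
    refine h1.congr fun s hs => ?_
    rw [uIoc_of_le hc.le] at hs
    rw [hmul s (Ioc_subset_Icc_self hs)]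
    push_cast
    ring
  have heq : ∫ s in (0 : ℝ)..c, ((s ^ (μ - 1) : ℝ) : ℂ) * k s *
      (Complex.exp (Complex.I * t * ((s * (2 * a - s) : ℝ) : ℂ)) *
        (Complex.I * t * ((2 * (a - s) : ℝ) : ℂ))) = Complex.I * t *
      ((∫ s in (0 : ℝ)..c, ((s ^ (μ - 1) : ℝ) : ℂ) * w s *
        Complex.exp (Complex.I * t * ((s * (2 * a - s) : ℝ) : ℂ))) -
        A * ∫ z in (0 : ℝ)..(c * (2 * a - c)), ((z ^ (μ - 1) : ℝ) : ℂ) *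
          Complex.exp (Complex.I * t * z)) := by
    rw [← integral_comp_quadratic_rpow_mul_exp hc hca hμ hμ1, ← intervalIntegral.integral_const_mul,
      ← intervalIntegral.integral_sub hX (hY.const_mul A), ← intervalIntegral.integral_const_mul]
    refine intervalIntegral.integral_congr fun s hs => ?_
    rw [uIcc_of_le hc.le] at hs
    simp only [k]
    rw [hmul s hs]
    have has : (a : ℂ) - s ≠ 0 := by
      rw [← Complex.ofReal_sub]; exact_mod_cast (by linarith [hs.2] : a - s ≠ 0)
    push_cast
    field_simp
  have hi : ∫ s in (0 : ℝ)..c, 2 * D * s ^ (μ - 1) = 2 * D * (c ^ μ / μ) := by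
    rw [intervalIntegral.integral_const_mul, integral_rpow (.inl (by linarith)), sub_add_cancel,
      Real.zero_rpow hμ.ne', sub_zero]
  have hu0 : ‖(((0 : ℝ) ^ (μ - 1) : ℝ) : ℂ) * k 0‖ = 0 := by rw [hk0, mul_zero, norm_zero]
  have huc' := huD c ⟨hc.le, le_rfl⟩
  rw [heq, hi, hu0, norm_mul, norm_mul, Complex.norm_I, Complex.norm_real,
    Real.norm_of_nonneg ht.le, one_mul] at hbp
  have hG := norm_integral_rpow_mul_exp_sub_le ht (mul_pos hc (by linarith : 0 < 2 * a - c)) hμ hμ1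
  have hσ : (c * (2 * a - c)) ^ (μ - 1) ≤ (c ^ 2) ^ (μ - 1) :=
    Real.rpow_le_rpow_of_nonpos (by positivity) (by nlinarith) (by linarith)
  set X := ∫ s in (0 : ℝ)..c, ((s ^ (μ - 1) : ℝ) : ℂ) * w s *
        Complex.exp (Complex.I * t * ((s * (2 * a - s) : ℝ) : ℂ))
  set Z := ∫ z in (0 : ℝ)..(c * (2 * a - c)), ((z ^ (μ - 1) : ℝ) : ℂ) *
          Complex.exp (Complex.I * t * z)
  set G := (Real.Gamma μ : ℂ) * Complex.exp (Complex.I * (Real.pi * μ / 2)) * ((t ^ (-μ) : ℝ) : ℂ)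
  change ‖X - A * G‖ ≤ _
  have h1 : ‖X - A * Z‖ ≤ D * (c ^ μ + 2 * (c ^ μ / μ)) / t := by
    rw [le_div_iff₀ ht]
    linarith
  have h2 : ‖A * (Z - G)‖ ≤ M * c ^ (-μ) * (2 * (c ^ 2) ^ (μ - 1)) / t := by
    rw [norm_mul]
    calc ‖A‖ * ‖Z - G‖ ≤ (M * c ^ (-μ)) * (2 * (c * (2 * a - c)) ^ (μ - 1) / t) := by
          gcongr
      _ ≤ (M * c ^ (-μ)) * (2 * (c ^ 2) ^ (μ - 1) / t) := by
          have : 0 ≤ c ^ (-μ) := Real.rpow_nonneg hc.le _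
          gcongr
      _ = _ := by ring
  calc ‖X - A * G‖ = ‖(X - A * Z) + A * (Z - G)‖ := by congr 1; ring
    _ ≤ _ := (norm_add_le _ _).trans (add_le_add h1 h2)
    _ = _ := by ring

/-! ### Asymptotics of the oscillatory integral -/

/-- One-sided stationary phase for an amplitude of class `C¹` at the stationary point `y = 0`. -/
theorem norm_integral_half_stationary_sub_le {h h' : ℝ → ℂ} {B M δ t : ℝ} (hB : 0 < B)
    (hδ : δ < 1) (ht : 0 < t)
    (hd : ∀ y ∈ Icc 0 B, HasDerivWithinAt h (h' y) (Icc 0 B) y) (hdc : ContinuousOn h' (Icc 0 B))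
    (hdle : ∀ y ∈ Icc 0 B, ‖h' y‖ ≤ M) :
    ‖(∫ y in (0 : ℝ)..B, h y * Complex.exp (-(Complex.I * t) * (y : ℂ) ^ 2)) -
      h 0 * ((Real.sqrt Real.pi : ℂ) / 2 * Complex.exp (-Complex.I * (Real.pi / 4)) *
        ((t ^ (-(1 / 2) : ℝ) : ℝ) : ℂ))‖ ≤
      M * (2 + B ^ (2 * (1 - δ)) / (2 * (1 - δ))) * (t ^ (-1 : ℝ) + t ^ (-δ)) +
        ‖h 0‖ / B * t ^ (-1 : ℝ) := by
  have h0 : (0 : ℝ) ∈ Icc 0 B := ⟨le_rfl, hB.le⟩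
  have hM : 0 ≤ M := (norm_nonneg _).trans (hdle 0 h0)
  have hc : ContinuousOn h (Icc 0 B) := fun y hy => (hd y hy).continuousWithinAt
  have h1 := norm_integral_mul_cexp_quadratic_le (h := fun y => h y - h 0) (h' := h') hB hM hδ ht
    (hc.sub continuousOn_const)
    (fun y hy => ((hd y (Ioo_subset_Icc_self hy)).hasDerivAt (Icc_mem_nhds hy.1 hy.2)).sub_const _)
    (hdc.mono Ioo_subset_Icc_self)
    (fun y hy => by
      have := Convex.norm_image_sub_le_of_norm_hasDerivWithin_le hd hdle (convex_Icc 0 B) h0 hy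
      rwa [sub_zero, Real.norm_of_nonneg hy.1] at this)
    (fun y hy => hdle y (Ioo_subset_Icc_self hy))
  have h2 := mul_le_mul_of_nonneg_left (norm_integral_fresnel_sub_le ht hB) (norm_nonneg (h 0))
  rw [← norm_mul] at h2
  have h3 : ∫ y in (0 : ℝ)..B, (h y - h 0) * Complex.exp (-(Complex.I * t) * (y : ℂ) ^ 2) =
      (∫ y in (0 : ℝ)..B, h y * Complex.exp (-(Complex.I * t) * (y : ℂ) ^ 2)) -
        h 0 * ∫ y in (0 : ℝ)..B, Complex.exp (-(Complex.I * t) * (y : ℂ) ^ 2) := by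
    rw [← intervalIntegral.integral_const_mul, ← intervalIntegral.integral_sub]
    · simp only [sub_mul]
    · refine ContinuousOn.intervalIntegrable ?_
      rw [uIcc_of_le hB.le]
      exact hc.mul (by fun_prop)
    · exact Continuous.intervalIntegrable (by fun_prop) _ _
  rw [h3] at h1
  have h4 : ‖h 0‖ * (1 / (t * B)) = ‖h 0‖ / B * t ^ (-1 : ℝ) := by
    rw [Real.rpow_neg_one]; field_simp
  rw [h4] at h2
  refine le_trans (le_of_eq ?_) ((norm_add_le _ _).trans (add_le_add h1 h2))
  congr 1
  ring

/-- Stationary phase at an interior point `p₀`, for an amplitude of class `C¹` on `[q, p₂]`. -/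
theorem norm_integral_stationary_sub_le {f f' : ℝ → ℂ} {q p₂ p₀ B M δ t : ℝ} (hB : 0 < B)
    (hq : q + B ≤ p₀) (hp₂ : p₀ + B ≤ p₂) (hδ : δ < 1) (ht : 0 < t)
    (hd : ∀ p ∈ Icc q p₂, HasDerivWithinAt f (f' p) (Icc q p₂) p) (hdc : ContinuousOn f' (Icc q p₂))
    (hle : ∀ p ∈ Icc q p₂, ‖f p‖ ≤ M) (hdle : ∀ p ∈ Icc q p₂, ‖f' p‖ ≤ M) :
    ‖(∫ p in q..p₂, f p * Complex.exp (-(Complex.I * t) * ((p - p₀ : ℝ) : ℂ) ^ 2)) -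
      f p₀ * ((Real.sqrt Real.pi : ℂ) * Complex.exp (-Complex.I * (Real.pi / 4)) *
        ((t ^ (-(1 / 2) : ℝ) : ℝ) : ℂ))‖ ≤
      2 * (M * (2 + (p₂ - q) ^ (2 * (1 - δ)) / (2 * (1 - δ))) + M / B) *
        (t ^ (-1 : ℝ) + t ^ (-δ)) := by
  have hqp : q ≤ p₂ := by linarith
  have hM : 0 ≤ M := (norm_nonneg _).trans (hle q ⟨le_rfl, hqp⟩)
  have hη : 0 < 2 * (1 - δ) := by linarith
  have ht1 : 0 ≤ t ^ (-1 : ℝ) := Real.rpow_nonneg ht.le _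
  have htδ : 0 ≤ t ^ (-δ) := Real.rpow_nonneg ht.le _
  have hp₀ : p₀ ∈ Icc q p₂ := ⟨by linarith, by linarith⟩
  have hci : ∀ a b, q ≤ a → a ≤ b → b ≤ p₂ → IntervalIntegrable (fun p => f p *
      Complex.exp (-(Complex.I * t) * ((p - p₀ : ℝ) : ℂ) ^ 2)) volume a b := fun a b ha hab hb => by
    refine ContinuousOn.intervalIntegrable ?_
    rw [uIcc_of_le hab]
    refine ContinuousOn.mul (fun p hp => ?_) (by fun_prop)
    exact (hd p ⟨ha.trans hp.1, hp.2.trans hb⟩).continuousWithinAt.mono (Icc_subset_Icc ha hb)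
  have hbound : ∀ L, B ≤ L → L ≤ p₂ - q →
      M * (2 + L ^ (2 * (1 - δ)) / (2 * (1 - δ))) * (t ^ (-1 : ℝ) + t ^ (-δ)) +
        ‖f p₀‖ / L * t ^ (-1 : ℝ) ≤ (M * (2 + (p₂ - q) ^ (2 * (1 - δ)) / (2 * (1 - δ))) + M / B) *
        (t ^ (-1 : ℝ) + t ^ (-δ)) := by
    intro L hBL hL
    have hL0 : 0 < L := hB.trans_le hBL
    rw [add_mul]
    refine add_le_add (by gcongr) ?_
    refine mul_le_mul ?_ (by linarith) ht1 (by positivity)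
    exact div_le_div₀ hM (hle p₀ hp₀) hB hBL
  have hr : ‖(∫ p in p₀..p₂, f p * Complex.exp (-(Complex.I * t) * ((p - p₀ : ℝ) : ℂ) ^ 2)) -
      f p₀ * ((Real.sqrt Real.pi : ℂ) / 2 * Complex.exp (-Complex.I * (Real.pi / 4)) *
        ((t ^ (-(1 / 2) : ℝ) : ℝ) : ℂ))‖ ≤
      (M * (2 + (p₂ - q) ^ (2 * (1 - δ)) / (2 * (1 - δ))) + M / B) * (t ^ (-1 : ℝ) + t ^ (-δ)) := by
    have hmaps : MapsTo (fun y => p₀ + y) (Icc 0 (p₂ - p₀)) (Icc q p₂) := fun y hy =>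
      ⟨by linarith [hy.1], by linarith [hy.2]⟩
    have h := norm_integral_half_stationary_sub_le (h := fun y => f (p₀ + y))
      (h' := fun y => f' (p₀ + y)) (B := p₂ - p₀) (M := M) (by linarith) hδ ht
      (fun y hy => by
        have := (hd _ (hmaps hy)).scomp y
          ((hasDerivAt_id y).const_add p₀).hasDerivWithinAt hmaps
        simpa using! this)
      (hdc.comp (by fun_prop) hmaps) (fun y hy => hdle _ (hmaps hy))
    simp only [add_zero] at h
    have hsub := intervalIntegral.integral_comp_add_left (a := 0) (b := p₂ - p₀)
      (fun p => f p * Complex.exp (-(Complex.I * t) * ((p - p₀ : ℝ) : ℂ) ^ 2)) p₀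
    simp only [add_zero, add_sub_cancel, add_sub_cancel_left] at hsub
    rw [← hsub]
    exact h.trans (hbound _ (by linarith) (by linarith))
  have hl : ‖(∫ p in q..p₀, f p * Complex.exp (-(Complex.I * t) * ((p - p₀ : ℝ) : ℂ) ^ 2)) -
      f p₀ * ((Real.sqrt Real.pi : ℂ) / 2 * Complex.exp (-Complex.I * (Real.pi / 4)) *
        ((t ^ (-(1 / 2) : ℝ) : ℝ) : ℂ))‖ ≤
      (M * (2 + (p₂ - q) ^ (2 * (1 - δ)) / (2 * (1 - δ))) + M / B) * (t ^ (-1 : ℝ) + t ^ (-δ)) := by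
    have hmaps : MapsTo (fun y => p₀ - y) (Icc 0 (p₀ - q)) (Icc q p₂) := fun y hy =>
      ⟨by linarith [hy.2], by linarith [hy.1]⟩
    have h := norm_integral_half_stationary_sub_le (h := fun y => f (p₀ - y))
      (h' := fun y => -f' (p₀ - y)) (B := p₀ - q) (M := M) (by linarith) hδ ht
      (fun y hy => by
        have := (hd _ (hmaps hy)).scomp y
          ((hasDerivAt_id y).const_sub p₀).hasDerivWithinAt hmaps
        simpa using! this)
      (hdc.comp (by fun_prop) hmaps).neg (fun y hy => by rw [norm_neg]; exact hdle _ (hmaps hy))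
    simp only [sub_zero] at h
    have hsub := intervalIntegral.integral_comp_sub_left (a := 0) (b := p₀ - q)
      (fun p => f p * Complex.exp (-(Complex.I * t) * ((p - p₀ : ℝ) : ℂ) ^ 2)) p₀
    simp only [sub_zero, sub_sub_cancel, sub_sub_cancel_left, Complex.ofReal_neg, neg_sq] at hsub
    rw [← hsub]
    exact h.trans (hbound _ (by linarith) (by linarith))
  rw [← intervalIntegral.integral_add_adjacent_intervals (hci q p₀ le_rfl hp₀.1 hp₀.2)
    (hci p₀ p₂ hp₀.1 hp₀.2 le_rfl)]
  refine le_trans (le_of_eq ?_) ((norm_add_le _ _).trans ((add_le_add hl hr).trans_eq (by ring)))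
  congr 1
  ring

/-- Asymptotics of the oscillatory integral with a singular endpoint `p₁` and a stationary point `p₀`,
with an error uniform in `p₀` as long as it keeps away from both endpoints. The interval is cut at
`p₁ + c`, between the singularity and the stationary point. -/
theorem exists_norm_integral_singular_stationary_sub_le {w w' : ℝ → ℂ} {p₁ p₂ μ δ c M : ℝ}
    (hμ : 0 < μ) (hμ1 : μ < 1) (hδ : δ < 1) (hc : 0 < c)
    (hw : ∀ p ∈ Icc p₁ p₂, HasDerivWithinAt w (w' p) (Icc p₁ p₂) p)
    (hw'c : ContinuousOn w' (Icc p₁ p₂)) (hwM : ∀ p ∈ Icc p₁ p₂, ‖w p‖ ≤ M)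
    (hw'M : ∀ p ∈ Icc p₁ p₂, ‖w' p‖ ≤ M) :
    ∃ C, 0 ≤ C ∧ ∀ p₀ t : ℝ, p₁ + 2 * c ≤ p₀ → p₀ + c ≤ p₂ → 0 < t →
      ‖(∫ p in p₁..p₂, (((p - p₁) ^ (μ - 1) : ℝ) : ℂ) * w p *
          Complex.exp (-(Complex.I * t) * ((p - p₀ : ℝ) : ℂ) ^ 2)) -
        (((p₀ - p₁) ^ (μ - 1) : ℝ) : ℂ) * w p₀ * ((Real.sqrt Real.pi : ℂ) *
          Complex.exp (-Complex.I * (Real.pi / 4)) * ((t ^ (-(1 / 2) : ℝ) : ℝ) : ℂ)) -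
        Complex.exp (-(Complex.I * t) * ((p₀ - p₁ : ℝ) : ℂ) ^ 2) *
          (w p₁ * (((2 * (p₀ - p₁)) ^ (-μ) : ℝ) : ℂ) * ((Real.Gamma μ : ℂ) *
            Complex.exp (Complex.I * (Real.pi * μ / 2)) * ((t ^ (-μ) : ℝ) : ℂ)))‖ ≤
      C * (t ^ (-1 : ℝ) + t ^ (-δ)) := by
  -- otherwise there is no admissible `p₀`
  rcases lt_or_ge p₂ (p₁ + 2 * c + c) with hlt | hge
  · exact ⟨0, le_rfl, fun p₀ t h1 h2 _ => by linarith⟩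
  have hη : 0 < 2 * (1 - δ) := by linarith
  have hM : 0 ≤ M := (norm_nonneg _).trans (hwM p₁ ⟨le_rfl, by linarith⟩)
  set M' := M * c ^ (μ - 1 - 1) + M * c ^ (μ - 1) with hM'def
  have hM' : 0 ≤ M' := by positivity
  set C₁ := (M / c + 2 * M / c ^ 2) * (c ^ μ + 2 * (c ^ μ / μ)) +
        M * c ^ (-μ) * (2 * (c ^ 2) ^ (μ - 1)) with hC₁
  set C₂ := 2 * (M' * (2 + (p₂ - (p₁ + c)) ^ (2 * (1 - δ)) / (2 * (1 - δ))) + M' / c) with hC₂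
  have hpq : 0 ≤ p₂ - (p₁ + c) := by linarith
  have hC₁0 : 0 ≤ C₁ := by positivity
  have hC₂0 : 0 ≤ C₂ := by positivity
  refine ⟨C₁ + C₂, by positivity, fun p₀ t hp₀ hp₀' ht => ?_⟩
  have hsub : Icc (p₁ + c) p₂ ⊆ Icc p₁ p₂ := Icc_subset_Icc_left (by linarith)
  let f : ℝ → ℂ := fun p => (((p - p₁) ^ (μ - 1) : ℝ) : ℂ) * w p
  let f' : ℝ → ℂ := fun p => (((μ - 1) * (p - p₁) ^ (μ - 1 - 1) : ℝ) : ℂ) * w p +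
    (((p - p₁) ^ (μ - 1) : ℝ) : ℂ) * w' p
  have hwc : ContinuousOn w (Icc p₁ p₂) := fun p hp => (hw p hp).continuousWithinAt
  have hfd : ∀ p ∈ Icc (p₁ + c) p₂, HasDerivWithinAt f (f' p) (Icc (p₁ + c) p₂) p := by
    intro p hp
    have h1 : HasDerivAt (fun p => (p - p₁) ^ (μ - 1)) ((μ - 1) * (p - p₁) ^ (μ - 1 - 1)) p := by
      refine (((hasDerivAt_id p).sub_const p₁).rpow_const (p := μ - 1)
        (.inl (by simp only [id]; linarith [hp.1]))).congr_deriv ?_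
      simp
    exact h1.ofReal_comp.hasDerivWithinAt.mul ((hw p (hsub hp)).mono hsub)
  have hrc : ∀ r : ℝ, ContinuousOn (fun p => (p - p₁) ^ r) (Icc (p₁ + c) p₂) := fun r =>
    ContinuousOn.rpow_const (by fun_prop) fun p hp => .inl (by linarith [hp.1])
  have hf'c : ContinuousOn f' (Icc (p₁ + c) p₂) :=
    ((Complex.continuous_ofReal.comp_continuousOn (continuousOn_const.mul (hrc _))).mul
      (hwc.mono hsub)).add ((Complex.continuous_ofReal.comp_continuousOn (hrc _)).mul
      (hw'c.mono hsub))
  have hrle : ∀ r ≤ (0 : ℝ), ∀ p ∈ Icc (p₁ + c) p₂, |(p - p₁) ^ r| ≤ c ^ r := by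
    intro r hr p hp
    rw [abs_of_nonneg (Real.rpow_nonneg (by linarith [hp.1]) r)]
    exact Real.rpow_le_rpow_of_nonpos hc (by linarith [hp.1]) hr
  have hfM : ∀ p ∈ Icc (p₁ + c) p₂, ‖f p‖ ≤ M' := by
    intro p hp
    have h1 := hrle (μ - 1) (by linarith) p hp
    have h2 := hwM p (hsub hp)
    have h3 : 0 ≤ M * c ^ (μ - 1 - 1) := by positivity
    rw [norm_mul, Complex.norm_real, Real.norm_eq_abs]
    calc |(p - p₁) ^ (μ - 1)| * ‖w p‖ ≤ c ^ (μ - 1) * M := by gcongr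
      _ ≤ M' := by rw [hM'def]; linarith
  have hf'M : ∀ p ∈ Icc (p₁ + c) p₂, ‖f' p‖ ≤ M' := by
    intro p hp
    have h1 := hrle (μ - 1) (by linarith) p hp
    have h2 := hrle (μ - 1 - 1) (by linarith) p hp
    have h3 := hwM p (hsub hp)
    have h4 := hw'M p (hsub hp)
    have h5 : |μ - 1| ≤ 1 := by rw [abs_of_neg (by linarith)]; linarith
    refine (norm_add_le _ _).trans ?_
    rw [norm_mul, norm_mul, Complex.norm_real, Complex.norm_real, Real.norm_eq_abs,
      Real.norm_eq_abs, abs_mul]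
    calc |μ - 1| * |(p - p₁) ^ (μ - 1 - 1)| * ‖w p‖ + |(p - p₁) ^ (μ - 1)| * ‖w' p‖
        ≤ 1 * c ^ (μ - 1 - 1) * M + c ^ (μ - 1) * M := by gcongr
      _ = M' := by rw [hM'def]; ring
  have hstat := norm_integral_stationary_sub_le (f := f) (f' := f') (q := p₁ + c) (p₂ := p₂)
    (p₀ := p₀) hc (by linarith) hp₀' hδ ht hfd hf'c hfM hf'M
  have hmaps : MapsTo (fun s => p₁ + s) (Icc 0 c) (Icc p₁ p₂) := fun s hs =>
    ⟨by linarith [hs.1], by linarith [hs.2]⟩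
  have hend := norm_integral_endpoint_sub_le (w := fun s => w (p₁ + s)) (w' := fun s => w' (p₁ + s))
    (a := p₀ - p₁) (c := c) (μ := μ) (t := t) (M := M) hc (by linarith) hμ hμ1 ht
    (fun s hs => by
      have := (hw _ (hmaps hs)).scomp s
        ((hasDerivAt_id s).const_add p₁).hasDerivWithinAt hmaps
      simpa using! this)
    (hw'c.comp (by fun_prop) hmaps) (fun s hs => hwM _ (hmaps hs)) (fun s hs => hw'M _ (hmaps hs))
  simp only [add_zero] at hend
  have hphase : (∫ p in p₁..(p₁ + c), f p *
      Complex.exp (-(Complex.I * t) * ((p - p₀ : ℝ) : ℂ) ^ 2)) =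
      Complex.exp (-(Complex.I * t) * ((p₀ - p₁ : ℝ) : ℂ) ^ 2) *
      ∫ s in (0 : ℝ)..c, ((s ^ (μ - 1) : ℝ) : ℂ) * w (p₁ + s) *
        Complex.exp (Complex.I * t * ((s * (2 * (p₀ - p₁) - s) : ℝ) : ℂ)) := by
    have h1 := intervalIntegral.integral_comp_add_left (a := 0) (b := c)
      (fun p => f p * Complex.exp (-(Complex.I * t) * ((p - p₀ : ℝ) : ℂ) ^ 2)) p₁
    rw [add_zero] at h1
    rw [← h1, ← intervalIntegral.integral_const_mul]
    refine intervalIntegral.integral_congr fun s _ => ?_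
    simp only [f, add_sub_cancel_left]
    have h2 : Complex.exp (-(Complex.I * t) * ((p₁ + s - p₀ : ℝ) : ℂ) ^ 2) =
        Complex.exp (-(Complex.I * t) * ((p₀ - p₁ : ℝ) : ℂ) ^ 2) *
        Complex.exp (Complex.I * t * ((s * (2 * (p₀ - p₁) - s) : ℝ) : ℂ)) := by
      rw [← Complex.exp_add]
      congr 1
      push_cast
      ring
    rw [h2]
    ring
  have hi₁ : IntervalIntegrable (fun p => f p *
      Complex.exp (-(Complex.I * t) * ((p - p₀ : ℝ) : ℂ) ^ 2)) volume p₁ (p₁ + c) := by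
    have h1 : IntervalIntegrable (fun p => (((p - p₁) ^ (μ - 1) : ℝ) : ℂ)) volume p₁ (p₁ + c) := by
      have h2 := (intervalIntegral.intervalIntegrable_rpow' (a := 0) (b := c) (r := μ - 1)
        (by linarith)).comp_sub_right p₁
      rw [zero_add, add_comm c p₁] at h2
      exact ⟨h2.1.ofReal, h2.2.ofReal⟩
    refine (h1.mul_continuousOn ?_).mul_continuousOn (by fun_prop)
    rw [uIcc_of_le (by linarith)]
    exact hwc.mono (Icc_subset_Icc_right (by linarith))
  have hi₂ : IntervalIntegrable (fun p => f p *
      Complex.exp (-(Complex.I * t) * ((p - p₀ : ℝ) : ℂ) ^ 2)) volume (p₁ + c) p₂ := by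
    refine ContinuousOn.intervalIntegrable ?_
    rw [uIcc_of_le (by linarith)]
    exact ContinuousOn.mul (fun p hp => (hfd p hp).continuousWithinAt) (by fun_prop)
  have hunit : ‖Complex.exp (-(Complex.I * t) * ((p₀ - p₁ : ℝ) : ℂ) ^ 2)‖ = 1 :=
    norm_cexp_quadratic t (p₀ - p₁)
  change ‖(∫ p in p₁..p₂, f p * Complex.exp (-(Complex.I * t) * ((p - p₀ : ℝ) : ℂ) ^ 2)) -
    f p₀ * _ - _‖ ≤ _
  rw [← intervalIntegral.integral_add_adjacent_intervals hi₁ hi₂, hphase]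
  have hrotate : ∀ (X Y : ℂ) (b : ℝ), ‖X - Y‖ ≤ b →
      ‖Complex.exp (-(Complex.I * t) * ((p₀ - p₁ : ℝ) : ℂ) ^ 2) * X -
        Complex.exp (-(Complex.I * t) * ((p₀ - p₁ : ℝ) : ℂ) ^ 2) * Y‖ ≤ b := fun X Y b h => by
    rwa [← mul_sub, norm_mul, hunit, one_mul]
  have ht1 : C₁ / t ≤ C₁ * (t ^ (-1 : ℝ) + t ^ (-δ)) := by
    rw [Real.rpow_neg_one, div_eq_mul_inv]
    exact mul_le_mul_of_nonneg_left (le_add_of_nonneg_right (Real.rpow_nonneg ht.le _)) hC₁0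
  have hend' := hrotate _ _ _ (hend.trans ht1)
  refine le_trans (le_of_eq ?_) ((norm_add_le _ _).trans ((add_le_add hend' hstat).trans_eq
    (add_mul _ _ _).symm))
  congr 1
  ring

/-! ### The expansion of the solution -/

theorem InitialCondition.formula {p₁ p₂ μ : ℝ} {u₀ : 𝓢'(ℝ, ℂ)} {U w : ℝ → ℂ}
    (hu₀ : InitialCondition p₁ p₂ μ u₀ U w) {p : ℝ} (hp : p ∈ Ioo p₁ p₂) :
    U p = (((p - p₁) ^ (μ - 1) : ℝ) : ℂ) * w p := by
  rw [hu₀.amplitude.formula p hp]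
  simp

theorem InitialCondition.integrable {p₁ p₂ μ : ℝ} (hp : p₁ < p₂) (hμ : 0 < μ) {u₀ : 𝓢'(ℝ, ℂ)}
    {U w : ℝ → ℂ} (hu₀ : InitialCondition p₁ p₂ μ u₀ U w) : Integrable U := by
  have h1 : IntervalIntegrable (fun p => (((p - p₁) ^ (μ - 1) : ℝ) : ℂ) * w p) volume p₁ p₂ := by
    have h2 := (intervalIntegral.intervalIntegrable_rpow' (a := 0) (b := p₂ - p₁) (r := μ - 1)
      (by linarith)).comp_sub_right p₁
    rw [zero_add, sub_add_cancel] at h2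
    refine (show IntervalIntegrable (fun p => (((p - p₁) ^ (μ - 1) : ℝ) : ℂ)) volume p₁ p₂ from
      ⟨h2.1.ofReal, h2.2.ofReal⟩).mul_continuousOn ?_
    rw [uIcc_of_le hp.le]
    exact hu₀.amplitude.contDiffOn.continuousOn
  rw [intervalIntegrable_iff_integrableOn_Ioo_of_le hp.le] at h1
  have h3 : IntegrableOn U (Icc p₁ p₂) := by
    rw [integrableOn_Icc_iff_integrableOn_Ioo]
    exact h1.congr_fun (fun p hp => (hu₀.formula hp).symm) measurableSet_Ioo
  exact integrableOn_iff_integrable_of_support_subset (fun p hp' => by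
    by_contra h
    exact hp' (hu₀.eq_zero_outside p h)) |>.1 h3

theorem InitialCondition.integral_mul {p₁ p₂ μ : ℝ} (hp : p₁ < p₂) {u₀ : 𝓢'(ℝ, ℂ)}
    {U w : ℝ → ℂ} (hu₀ : InitialCondition p₁ p₂ μ u₀ U w) (e : ℝ → ℂ) :
    ∫ p, U p * e p = ∫ p in p₁..p₂, (((p - p₁) ^ (μ - 1) : ℝ) : ℂ) * w p * e p := by
  rw [← setIntegral_eq_integral_of_forall_compl_eq_zero (s := Icc p₁ p₂)
    (fun p hp => by rw [hu₀.eq_zero_outside p hp, zero_mul]), integral_Icc_eq_integral_Ioo,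
    intervalIntegral.integral_of_le hp.le, integral_Ioc_eq_integral_Ioo]
  exact setIntegral_congr_fun measurableSet_Ioo fun p hp => by simp only [hu₀.formula hp]

end FreeSchrodinger

theorem theorem2p2 (p₁ p₂ μ : ℝ) (hp : p₁ < p₂) (hμ : μ ∈ Set.Ioo (0 : ℝ) 1)
    (u₀ : 𝓢'(ℝ, ℂ)) (U w : ℝ → ℂ)
    (hu₀ : FreeSchrodinger.InitialCondition p₁ p₂ μ u₀ U w)
    (δ : ℝ) (hδ : δ ∈ Set.Ioo (max μ (1 / 2)) 1)
    (ε₁ ε₂ : ℝ) (hε₁ : 0 < ε₁) (hε₂ : 0 < ε₂) (hε : p₁ + ε₁ < p₂ - ε₂) :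
    ∃ c : ℝ, 0 ≤ c ∧
      ∀ u : ℝ → ℝ → ℂ, FreeSchrodinger.IsSolution u₀ u →
        ∀ t x : ℝ, 0 < t → p₁ + ε₁ ≤ x / (2 * t) → x / (2 * t) ≤ p₂ - ε₂ →
          ‖u t x
              - FreeSchrodinger.coeffH p₁ μ w t x * ((t ^ (-(1 / 2) : ℝ) : ℝ) : ℂ)
              - FreeSchrodinger.coeffK p₁ μ w t x * ((t ^ (-μ) : ℝ) : ℂ)‖
            ≤ c * (t ^ (-1 : ℝ) + t ^ (-δ)) := by
  have hdiff := hu₀.amplitude.contDiffOn.differentiableOn (by norm_num)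
  have hw'c : ContinuousOn (derivWithin w (Icc p₁ p₂)) (Icc p₁ p₂) :=
    hu₀.amplitude.contDiffOn.continuousOn_derivWithin (uniqueDiffOn_Icc hp) (by norm_num)
  obtain ⟨M₁, hM₁⟩ := isCompact_Icc.exists_bound_of_continuousOn hdiff.continuousOn
  obtain ⟨M₂, hM₂⟩ := isCompact_Icc.exists_bound_of_continuousOn hw'c
  obtain ⟨C, hC, hbound⟩ := FreeSchrodinger.exists_norm_integral_singular_stationary_sub_le
    (c := min (ε₁ / 2) ε₂) (M := max M₁ M₂) hμ.1 hμ.2 hδ.2 (lt_min (half_pos hε₁) hε₂)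
    (fun p hp => (hdiff p hp).hasDerivWithinAt) hw'c
    (fun p hp => (hM₁ p hp).trans (le_max_left _ _))
    (fun p hp => (hM₂ p hp).trans (le_max_right _ _))
  refine ⟨(2 * Real.pi)⁻¹ * C, by positivity, fun u hu t x ht hx₁ hx₂ => ?_⟩
  set p₀ := x / (2 * t) with hp₀
  have hx : x = 2 * t * p₀ := by rw [hp₀]; field_simp
  have h1 := hbound p₀ t (by linarith [min_le_left (ε₁ / 2) ε₂])
    (by linarith [min_le_right (ε₁ / 2) ε₂]) ht
  have hint : u t x = (2 * Real.pi : ℂ)⁻¹ * (Complex.exp (Complex.I * t * p₀ ^ 2) *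
      ∫ p in p₁..p₂, (((p - p₁) ^ (μ - 1) : ℝ) : ℂ) * w p *
          Complex.exp (-(Complex.I * t) * ((p - p₀ : ℝ) : ℂ) ^ 2)) := by
    rw [hu.eq_integral hu₀.fourier_eq (hu₀.integrable hp hμ.1) ht x, hu₀.integral_mul hp,
      ← intervalIntegral.integral_const_mul (Complex.exp (Complex.I * t * p₀ ^ 2))]
    refine congr_arg _ (intervalIntegral.integral_congr fun p _ => ?_)
    rw [mul_left_comm, ← Complex.exp_add, hx]
    congr 2
    push_cast
    ring
  have hH : FreeSchrodinger.coeffH p₁ μ w t x = (2 * Real.pi : ℂ)⁻¹ *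
      (Complex.exp (Complex.I * t * p₀ ^ 2) * ((((p₀ - p₁) ^ (μ - 1) : ℝ) : ℂ) * w p₀ *
        ((Real.sqrt Real.pi : ℂ) * Complex.exp (-Complex.I * (Real.pi / 4))))) := by
    have hs : (Real.sqrt Real.pi : ℂ) ≠ 0 := by
      exact_mod_cast (Real.sqrt_pos.2 Real.pi_pos).ne'
    have hs2 : (Real.pi : ℂ) = (Real.sqrt Real.pi : ℂ) ^ 2 := by
      rw [← Complex.ofReal_pow, Real.sq_sqrt Real.pi_pos.le]
    have hcoef : 1 / (2 * (Real.sqrt Real.pi : ℂ)) =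
        (2 * Real.pi : ℂ)⁻¹ * (Real.sqrt Real.pi : ℂ) := by
      rw [hs2]; field_simp
    have hph : Complex.exp (Complex.I * (x ^ 2 / (4 * t))) =
        Complex.exp (Complex.I * t * p₀ ^ 2) := by
      have : (t : ℂ) ≠ 0 := by exact_mod_cast ht.ne'
      congr 1
      rw [hx]
      push_cast
      field_simp
      ring
    rw [FreeSchrodinger.coeffH, ← hp₀, hcoef, hph]
    ring
  have hK : FreeSchrodinger.coeffK p₁ μ w t x = (2 * Real.pi : ℂ)⁻¹ *
      (Complex.exp (Complex.I * t * p₀ ^ 2) *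
        (Complex.exp (-(Complex.I * t) * ((p₀ - p₁ : ℝ) : ℂ) ^ 2) *
          (w p₁ * (((2 * (p₀ - p₁)) ^ (-μ) : ℝ) : ℂ) * ((Real.Gamma μ : ℂ) *
            Complex.exp (Complex.I * (Real.pi * μ / 2)))))) := by
    have hcoef : Real.Gamma μ / (2 ^ (μ + 1) * Real.pi) * (p₀ - p₁) ^ (-μ) =
        (2 * Real.pi)⁻¹ * Real.Gamma μ * (2 * (p₀ - p₁)) ^ (-μ) := by
      rw [Real.mul_rpow two_pos.le (by linarith), Real.rpow_add two_pos, Real.rpow_one,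
        Real.rpow_neg two_pos.le]
      have : (2 : ℝ) ^ μ ≠ 0 := (Real.rpow_pos_of_pos two_pos μ).ne'
      field_simp
    have hcoef' := congr_arg Complex.ofReal hcoef
    have hph : Complex.exp (Complex.I * (-t * p₁ ^ 2 + x * p₁)) =
        Complex.exp (Complex.I * t * p₀ ^ 2) *
          Complex.exp (-(Complex.I * t) * ((p₀ - p₁ : ℝ) : ℂ) ^ 2) := by
      rw [← Complex.exp_add, hx]
      congr 1
      push_cast
      ring
    rw [Complex.ofReal_mul, Complex.ofReal_mul (_ * _), Complex.ofReal_mul (_⁻¹)] at hcoef'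
    rw [FreeSchrodinger.coeffK, ← hp₀, hph]
    push_cast at hcoef' ⊢
    linear_combination (Complex.exp (Complex.I * (Real.pi * μ / 2)) *
      (Complex.exp (Complex.I * t * p₀ ^ 2) *
        Complex.exp (-(Complex.I * t) * ((p₀ : ℂ) - p₁) ^ 2)) * w p₁) * hcoef'
  have hunit : ‖(2 * Real.pi : ℂ)⁻¹ * Complex.exp (Complex.I * t * p₀ ^ 2)‖ = (2 * Real.pi)⁻¹ := by
    have h2 : ‖Complex.exp (Complex.I * t * (p₀ : ℂ) ^ 2)‖ = 1 := by
      rw [Complex.norm_exp, ← Complex.ofReal_pow, Complex.re_mul_ofReal]; simp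
    rw [norm_mul, h2, mul_one, norm_inv, norm_mul, Complex.norm_ofNat, Complex.norm_real,
      Real.norm_of_nonneg Real.pi_pos.le]
  have h3 := mul_le_mul_of_nonneg_left h1 (inv_nonneg.2 Real.two_pi_pos.le)
  rw [← hunit, ← norm_mul, hunit] at h3
  refine ((le_of_eq ?_).trans h3).trans_eq (mul_assoc _ _ _).symm
  rw [hint, hH, hK]
  congr 1
  ring
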